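/- There are absolute constants $s_0,c_0,C,K>0$ such that the following holds for all integers $d,n\ge 1$. Let $\Theta=\{\theta\in\mathbb R^d:\ \theta_j>0\ (1\le j\le d),\ \theta_1+\dots+\theta_d<1\}$ and write $\theta_0=1-\sum_{j=1}^d\theta_j$ for $\theta\in\Theta$. Let $\theta^*\in\Theta$, $\theta^*_{\min}=\min_{0\le j\le d}\theta^*_j$, and let $N=(N_0,\dots,N_d)\sim\mathrm{Multi}(n,\theta^*)$ be the vector of counts of $n$ i.i.d. draws from the pmf $(\theta_0^*,\dots,\theta_d^*)$. Put $$\ell(\theta)=-\sum_{j=0}^d\frac{N_j}{n}\log\theta_j,\qquad F^*=\mathrm{diag}\big((1/\theta_j^*)_{j=1}^d\big)+\frac1{\theta_0^*}\mathbf 1\mathbf 1^{\top},$$ and $|u|_{F^*}=(u^\top F^*u)^{1/2}$, $\|g\|_{F^*}=\sup_{|u|_{F^*}=1}\langle g,u\rangle$ for $u,g\in\mathbb R^d$. Let $\rho$ be a prior density, up to normalization: a function on $\mathbb R^d$ that is nonnegative and integrable on $\Theta$. For $r>0$ let $$U^*(r)=\{\theta\in\mathbb R^d:\ |\theta-\theta^*|_{F^*}\le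 r\sqrt{d/n}\},\qquad \delta^*_{01}(r)=\sup_{\theta\in U^*(r)}\|\nabla\log\rho(\theta)\|_{F^*},$$ with $\delta^*_{01}(r)=\infty$ if $\rho$ is not $C^1$ or not strictly positive on $U^*(r)$, and let $$M_0^*=\frac1d\log\frac{\sup_{\theta\in\Theta}\rho(\theta)}{\rho(\theta^*)}\in[0,\infty].$$ Let $\pi$ be the posterior, i.e. the probability distribution on $\Theta$ with density proportional to $e^{-n\ell(\theta)}\rho(\theta)$. Suppose that $s\ge s_0$, that $\dfrac{s^2d}{n\theta^*_{\min}}\le c_0$, and that $\delta^*_{01}(2s)\le\sqrt{nd}/6$. Then, on an event of probability at least $1-\exp(-Cds^2)$, the posterior $\pi$ is well defined, $\ell$ has a unique minimizer $\hat\theta$ over $\Theta$ (the maximum likelihood estimator), and $$\mathrm{TV}\Big(\pi,\ \mathcal N\big(\hat\theta,(nF^*)^{-1}\big)\Big)\ \le\ K\left(\frac{sd}{\sqrt{n\theta^*_{\min}}}+\frac{\delta^*_{01}(2s)}{\sqrt n}+e^{d(M_0^*-Cs^2)}\right),$$ where $\mathrm{TV}(\mu,\nu)=\sup_A|\mu(A)-\nu(A)|$.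 -/

import Mathlib

open MeasureTheory ProbabilityTheory

namespace MultinomialBvM

/-- The parameter space: the probabilities `(θ₁, …, θ_d)` of the states `1, …, d`, such that all of
the `d + 1` probabilities, including `θ₀ = 1 - θ₁ - ⋯ - θ_d`, are strictly positive. -/
def paramSpace (d : ℕ) : Set (EuclideanSpace ℝ (Fin d)) :=
  {θ | (∀ j, 0 < θ j) ∧ ∑ j, θ j < 1}

/-- The full vector `(θ₀, θ₁, …, θ_d)` with `θ₀ = 1 - θ₁ - ⋯ - θ_d`. -/
def full {d : ℕ} (θ : EuclideanSpace ℝ (Fin d)) : Fin (d + 1) → ℝ :=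
  Fin.cons (1 - ∑ j, θ j) (fun j => θ j)

/-- The smallest of the `d + 1` probabilities. -/
noncomputable def minProb {d : ℕ} (θ : EuclideanSpace ℝ (Fin d)) : ℝ :=
  ⨅ j, full θ j

/-- The law on the states `0, …, d` which gives state `j` the probability `θ_j`. -/
noncomputable def categorical {d : ℕ} (θ : EuclideanSpace ℝ (Fin d)) : Measure (Fin (d + 1)) :=
  ∑ j, ENNReal.ofReal (full θ j) • Measure.dirac j

/-- The vector of counts `N_j = #{i | x_i = j}` of a sample. -/
def counts {d n : ℕ} (x : Fin n → Fin (d + 1)) : Fin (d + 1) → ℕ :=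
  fun j => (Finset.univ.filter fun i => x i = j).card

/-- The multinomial law with `n` trials and probabilities `θ₀, …, θ_d`: the law of the counts of
`n` i.i.d. draws from the pmf. -/
noncomputable def multinomial {d : ℕ} (n : ℕ) (θ : EuclideanSpace ℝ (Fin d)) :
    Measure (Fin (d + 1) → ℕ) :=
  (Measure.pi fun _ : Fin n => categorical θ).map counts

/-- The negative normalized log likelihood `ℓ(θ) = -∑ⱼ (N_j / n) log θ_j`. -/
noncomputable def negLogLik {d : ℕ} (n : ℕ) (N : Fin (d + 1) → ℕ)
    (θ : EuclideanSpace ℝ (Fin d)) : ℝ :=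
  -∑ j, ((N j : ℝ) / n) * Real.log (full θ j)

/-- `θ` is a maximum likelihood estimator: a minimizer of `ℓ` over the parameter space. -/
def IsMLE {d : ℕ} (n : ℕ) (N : Fin (d + 1) → ℕ) (θ : EuclideanSpace ℝ (Fin d)) : Prop :=
  θ ∈ paramSpace d ∧ IsMinOn (negLogLik n N) (paramSpace d) θ

/-- The Fisher information matrix `diag(1 / θ₁, …, 1 / θ_d) + (1 / θ₀) 𝟙 𝟙ᵀ`. -/
noncomputable def fisher {d : ℕ} (θ : EuclideanSpace ℝ (Fin d)) : Matrix (Fin d) (Fin d) ℝ :=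
  Matrix.diagonal (fun j => 1 / θ j) + Matrix.of fun _ _ => 1 / full θ 0

/-- The weighted Euclidean norm `|u|_A = |A^{1/2} u| = (uᵀ A u)^{1/2}`. -/
noncomputable def wnorm {d : ℕ} (A : Matrix (Fin d) (Fin d) ℝ) (u : EuclideanSpace ℝ (Fin d)) : ℝ :=
  Real.sqrt (u.ofLp ⬝ᵥ A.mulVec u.ofLp)

/-- The weighted operator norm `‖S‖_A = sup {⟨S, u⟩ : |u|_A = 1}` of a `1`-linear form, which is
identified with the vector that represents it. -/
noncomputable def wopNorm {d : ℕ} (A : Matrix (Fin d) (Fin d) ℝ) (S : EuclideanSpace ℝ (Fin d)) :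
    ENNReal :=
  ⨆ (u : EuclideanSpace ℝ (Fin d)) (_ : wnorm A u = 1), ENNReal.ofReal (inner ℝ S u)

/-- The local neighbourhood `U*(r) = {θ : |θ - θ*|_{F*} ≤ r √(d/n)}`. -/
def nbhd {d : ℕ} (n : ℕ) (θs : EuclideanSpace ℝ (Fin d)) (r : ℝ) :
    Set (EuclideanSpace ℝ (Fin d)) :=
  {θ | wnorm (fisher θs) (θ - θs) ≤ r * Real.sqrt ((d : ℝ) / n)}

open Classical in
/-- `δ*₀₁(r) = sup {‖∇ log π(θ)‖_{F*} : θ ∈ U*(r)}`, which is `∞` by convention if the prior `π` is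
not strictly positive on `U*(r)` or not `C¹` there (at each point of `U*(r)` it is to have a
gradient, and the gradient is to be continuous on `U*(r)`). -/
noncomputable def delta01 {d : ℕ} (n : ℕ) (θs : EuclideanSpace ℝ (Fin d))
    (prior : EuclideanSpace ℝ (Fin d) → ℝ) (r : ℝ) : ENNReal :=
  if (∀ θ ∈ nbhd n θs r, 0 < prior θ ∧ DifferentiableAt ℝ prior θ) ∧
      ContinuousOn (gradient prior) (nbhd n θs r) then
    ⨆ θ ∈ nbhd n θs r, wopNorm (fisher θs) (gradient (fun η => Real.log (prior η)) θ)
  else ⊤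

/-- `M₀* = d⁻¹ log (sup_{θ ∈ Θ} π(θ) / π(θ*))`, which is `+∞` for an unbounded prior. -/
noncomputable def M0 {d : ℕ} (θs : EuclideanSpace ℝ (Fin d))
    (prior : EuclideanSpace ℝ (Fin d) → ℝ) : EReal :=
  ENNReal.log ((⨆ θ ∈ paramSpace d, ENNReal.ofReal (prior θ)) / ENNReal.ofReal (prior θs)) / (d : EReal)

/-- The unnormalized posterior, with density `e^{-nℓ(θ)} π(θ)` on the parameter space. -/
noncomputable def posteriorWeight {d : ℕ} (n : ℕ) (prior : EuclideanSpace ℝ (Fin d) → ℝ)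
    (N : Fin (d + 1) → ℕ) : Measure (EuclideanSpace ℝ (Fin d)) :=
  (volume.restrict (paramSpace d)).withDensity fun θ =>
    ENNReal.ofReal (Real.exp (-(n * negLogLik n N θ)) * prior θ)

/-- The posterior distribution. -/
noncomputable def posterior {d : ℕ} (n : ℕ) (prior : EuclideanSpace ℝ (Fin d) → ℝ)
    (N : Fin (d + 1) → ℕ) : Measure (EuclideanSpace ℝ (Fin d)) :=
  (posteriorWeight n prior N Set.univ)⁻¹ • posteriorWeight n prior N

/-- The total variation distance `sup_A |μ(A) - ν(A)|` of two probability measures. -/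
noncomputable def tv {α : Type*} [MeasurableSpace α] (μ ν : Measure α) : ENNReal :=
  ⨆ (A : Set α) (_ : MeasurableSet A), ENNReal.ofReal |μ.real A - ν.real A|

end MultinomialBvM

/-!
The maximum likelihood estimator is the vector `p` of empirical frequencies. A Chernoff bound
averaged over a ball of directions shows `|p - θ*|_{F*} ≤ (s / 2) √(d / n)` with high probability.

In coordinates centred at `p` in which `n F*` is the identity, the posterior has on the ball of
radius `s √d` a density proportional to `e^f` with respect to the standard Gaussian, where `∇f` is
small because the Hessian of `n ℓ` is close to the identity there. A Maurey–Pisier rotation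
argument, run only along the pairs of points whose rotations stay in the ball, bounds the double
Gaussian integral of `e^{2 (f(x) - f(y))}` and hence the `χ²` divergence and the total variation
distance between the two conditional laws on the ball.

Outside the ball, convexity of the Kullback–Leibler divergence turns its quadratic growth near `p`
into linear growth, so the posterior mass there is exponentially small up to the factor
`e^{d M₀*} = sup ρ / ρ(θ*)`.
-/

namespace MultinomialBvM

section TotalVariation
open scoped ENNReal
variable {α β : Type*} [MeasurableSpace α] [MeasurableSpace β]

lemma tv_comm (μ ν : Measure α) : tv μ ν = tv ν μ := by
  simp only [tv, abs_sub_comm]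

lemma ofReal_abs_sub_le_tv (μ ν : Measure α) {A : Set α} (hA : MeasurableSet A) :
    ENNReal.ofReal |μ.real A - ν.real A| ≤ tv μ ν :=
  le_iSup₂ (f := fun A (_ : MeasurableSet A) => ENNReal.ofReal |μ.real A - ν.real A|) A hA

lemma tv_triangle (μ ν ρ : Measure α) : tv μ ρ ≤ tv μ ν + tv ν ρ := by
  refine iSup₂_le fun A hA => ?_
  calc ENNReal.ofReal |μ.real A - ρ.real A|
      ≤ ENNReal.ofReal (|μ.real A - ν.real A| + |ν.real A - ρ.real A|) :=
        ENNReal.ofReal_le_ofReal (abs_sub_le _ _ _)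
    _ = ENNReal.ofReal |μ.real A - ν.real A| + ENNReal.ofReal |ν.real A - ρ.real A| :=
        ENNReal.ofReal_add (abs_nonneg _) (abs_nonneg _)
    _ ≤ tv μ ν + tv ν ρ := add_le_add (ofReal_abs_sub_le_tv μ ν hA) (ofReal_abs_sub_le_tv ν ρ hA)

lemma tv_le_one (μ ν : Measure α) [IsProbabilityMeasure μ] [IsProbabilityMeasure ν] :
    tv μ ν ≤ 1 := by
  refine iSup₂_le fun A _ => ENNReal.ofReal_le_one.2 (abs_le.2 ⟨?_, ?_⟩) <;>
    linarith [measureReal_nonneg (μ := μ) (s := A), measureReal_nonneg (μ := ν) (s := A),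
      measureReal_le_one (μ := μ) (s := A), measureReal_le_one (μ := ν) (s := A)]

lemma tv_map_le (μ ν : Measure α) {f : α → β} (hf : Measurable f) :
    tv (μ.map f) (ν.map f) ≤ tv μ ν := by
  refine iSup₂_le fun A hA => ?_
  rw [map_measureReal_apply hf hA, map_measureReal_apply hf hA]
  exact ofReal_abs_sub_le_tv μ ν (hf hA)

lemma tv_cond_le (μ : Measure α) [IsProbabilityMeasure μ] {B : Set α} (hB : MeasurableSet B) :
    tv μ μ[|B] ≤ μ Bᶜ := by
  refine iSup₂_le fun A _ => ?_
  rw [← ofReal_measureReal]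
  refine ENNReal.ofReal_le_ofReal ?_
  have hcond : μ[|B].real A * μ.real B = μ.real (A ∩ B) := by
    rw [Set.inter_comm, measureReal_def, measureReal_def, measureReal_def, ← ENNReal.toReal_mul,
      cond_mul_eq_inter hB]
  have hcond_le : μ[|B].real A ≤ 1 := by
    refine ENNReal.toReal_le_of_le_ofReal zero_le_one ?_
    rw [ENNReal.ofReal_one, cond_apply hB, mul_comm]
    exact ENNReal.div_le_of_le_mul (by simpa using measure_mono Set.inter_subset_left)
  have hcompl := probReal_add_probReal_compl hB (μ := μ)
  have hA := measureReal_inter_add_sdiff (μ := μ) (s := A) hB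
  have hsdiff : μ.real (A \ B) ≤ μ.real Bᶜ := measureReal_mono fun _ hx => hx.2
  have hsdiff₀ : 0 ≤ μ.real (A \ B) := measureReal_nonneg
  have hcond₀ : 0 ≤ μ[|B].real A := measureReal_nonneg
  rw [abs_le]
  constructor <;> nlinarith

lemma cond_smul (ν : Measure α) (B : Set α) {c : ℝ≥0∞} (hc : c ≠ 0) (hc' : c ≠ ∞) :
    (c • ν)[|B] = ν[|B] := by
  rw [ProbabilityTheory.cond, ProbabilityTheory.cond, Measure.restrict_smul, smul_smul,
    Measure.smul_apply, smul_eq_mul, ENNReal.mul_inv (.inl hc) (.inl hc'), mul_right_comm,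
    ENNReal.inv_mul_cancel hc hc', one_mul]

lemma cond_eq_restrict_cond_univ (ν : Measure α) (B : Set α) : ν[|B] = (ν.restrict B)[|.univ] := by
  simp [ProbabilityTheory.cond]

lemma tilted_eq_cond_univ {μ : Measure α} {f : α → ℝ}
    (hf : Integrable (fun x => Real.exp (f x)) μ) :
    μ.tilted f = (μ.withDensity fun x => ENNReal.ofReal (Real.exp (f x)))[|.univ] := by
  rcases eq_or_ne μ 0 with rfl | hμ
  · simp [ProbabilityTheory.cond]
  have : NeZero μ := ⟨hμ⟩
  have hpos : 0 < ∫ x, Real.exp (f x) ∂μ := integral_exp_pos hf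
  rw [ProbabilityTheory.cond, Measure.restrict_univ, withDensity_apply _ .univ,
    Measure.restrict_univ, ← ofReal_integral_eq_lintegral_ofReal hf
      (ae_of_all _ fun _ => (Real.exp_pos _).le), ← withDensity_smul' _ _ (by simpa using hpos),
    Measure.tilted]
  congr with x
  rw [Pi.smul_apply, smul_eq_mul, ← ENNReal.ofReal_inv_of_pos hpos,
    ← ENNReal.ofReal_mul (by positivity), div_eq_inv_mul]

lemma cond_eq_tilted {γ ν : Measure α} [IsFiniteMeasure γ] {B : Set α} (hγB : γ B ≠ 0) {f : α → ℝ}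
    {c : ℝ≥0∞} (hc : c ≠ 0) (hc' : c ≠ ∞)
    (hν : ν.restrict B = c • (γ.restrict B).withDensity fun x => ENNReal.ofReal (Real.exp (f x)))
    (hf : Integrable (fun x => Real.exp (f x)) γ[|B]) :
    ν[|B] = γ[|B].tilted f := by
  have hcond : γ[|B] = (γ B)⁻¹ • γ.restrict B := rfl
  rw [tilted_eq_cond_univ hf, cond_eq_restrict_cond_univ, hν, cond_smul _ _ hc hc', hcond,
    withDensity_smul_measure,
    cond_smul _ _ (ENNReal.inv_ne_zero.2 (measure_ne_top _ _)) (ENNReal.inv_ne_top.2 hγB)]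

end TotalVariation

section ExpIntegrability
open scoped ENNReal
variable {α : Type*} [MeasurableSpace α] {μ : Measure α}

lemma lintegral_prod_exp_sub [SFinite μ] {f : α → ℝ} (hf : AEMeasurable f μ) :
    ∫⁻ z, ENNReal.ofReal (Real.exp (f z.1 - f z.2)) ∂(μ.prod μ) =
      (∫⁻ x, ENNReal.ofReal (Real.exp (f x)) ∂μ) * ∫⁻ x, ENNReal.ofReal (Real.exp (-f x)) ∂μ := by
  rw [← lintegral_prod_mul (by fun_prop) (by fun_prop)]
  refine lintegral_congr fun z => ?_
  rw [← ENNReal.ofReal_mul (by positivity), ← Real.exp_add, sub_eq_add_neg]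

lemma lintegral_ofReal_exp_ne_zero [NeZero μ] {f : α → ℝ} (hf : AEMeasurable f μ) :
    ∫⁻ x, ENNReal.ofReal (Real.exp (f x)) ∂μ ≠ 0 := fun h => by
  obtain ⟨x, hx⟩ := ((lintegral_eq_zero_iff' (by fun_prop)).1 h).exists
  exact (Real.exp_pos (f x)).not_ge (ENNReal.ofReal_eq_zero.1 hx)

lemma integrable_exp_of_lintegral_ne_top {f : α → ℝ} (hf : AEMeasurable f μ)
    (h : ∫⁻ x, ENNReal.ofReal (Real.exp (f x)) ∂μ ≠ ∞) :
    Integrable (fun x => Real.exp (f x)) μ :=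
  (lintegral_ofReal_ne_top_iff_integrable (by fun_prop)
    (ae_of_all _ fun _ => (Real.exp_pos _).le)).1 h

lemma integrable_exp_of_lintegral_prod_exp_sub_ne_top [SFinite μ] [NeZero μ] {f : α → ℝ}
    (hf : AEMeasurable f μ)
    (h : ∫⁻ z, ENNReal.ofReal (Real.exp (f z.1 - f z.2)) ∂(μ.prod μ) ≠ ∞) :
    Integrable (fun x => Real.exp (f x)) μ ∧ Integrable (fun x => Real.exp (-f x)) μ := by
  rw [lintegral_prod_exp_sub hf] at h
  exact ⟨integrable_exp_of_lintegral_ne_top hf fun htop => h <| by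
      rw [htop, ENNReal.top_mul (lintegral_ofReal_exp_ne_zero hf.fun_neg)],
    integrable_exp_of_lintegral_ne_top hf.fun_neg fun htop => h <| by
      rw [htop, ENNReal.mul_top (lintegral_ofReal_exp_ne_zero hf)]⟩

lemma memLp_two_exp {f : α → ℝ} (hf : AEMeasurable f μ)
    (h : Integrable (fun x => Real.exp (2 * f x)) μ) : MemLp (fun x => Real.exp (f x)) 2 μ := by
  rw [memLp_two_iff_integrable_sq (by fun_prop)]
  simpa only [← Real.exp_nat_mul, Nat.cast_ofNat] using h

end ExpIntegrability

section ChiSquare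
open scoped ENNReal
variable {α : Type*} [MeasurableSpace α] {μ : Measure α} [IsProbabilityMeasure μ]

lemma sq_integral_le_integral_sq {X : α → ℝ} (hX : MemLp X 2 μ) :
    (∫ x, X x ∂μ) ^ 2 ≤ ∫ x, X x ^ 2 ∂μ :=
  sub_nonneg.1 ((variance_nonneg X μ).trans_eq (variance_eq_sub hX))

lemma integral_abs_sub_integral_le_sqrt_variance {X : α → ℝ} (hX : MemLp X 2 μ) :
    ∫ x, |X x - ∫ y, X y ∂μ| ∂μ ≤ √(Var[X; μ]) := by
  refine Real.le_sqrt_of_sq_le ?_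
  rw [variance_eq_integral hX.aemeasurable]
  have h := sq_integral_le_integral_sq (X := fun x => |X x - ∫ y, X y ∂μ|)
    (hX.sub (memLp_const (∫ y, X y ∂μ))).abs
  simpa only [sq_abs] using h

lemma one_le_integral_mul_integral_inv {X : α → ℝ} (hpos : ∀ x, 0 < X x) (hX : Integrable X μ)
    (hXinv : Integrable (fun x => (X x)⁻¹) μ) :
    1 ≤ (∫ x, X x ∂μ) * ∫ x, (X x)⁻¹ ∂μ := by
  set Z := ∫ x, X x ∂μ
  have hZ : 0 < Z := by
    refine (integral_pos_iff_support_of_nonneg (fun x => (hpos x).le) hX).2 ?_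
    simp [Function.support, (hpos _).ne']
  have htangent : ∀ x, 2 / Z - X x / Z ^ 2 ≤ (X x)⁻¹ := fun x => by
    have h : (X x)⁻¹ - (2 / Z - X x / Z ^ 2) = (X x - Z) ^ 2 / (X x * Z ^ 2) := by
      have := (hpos x).ne'
      field_simp
      ring
    have : 0 ≤ (X x - Z) ^ 2 / (X x * Z ^ 2) :=
      div_nonneg (sq_nonneg _) (mul_nonneg (hpos x).le (sq_nonneg _))
    linarith
  have hint := integral_mono ((integrable_const (2 / Z)).sub (hX.div_const (Z ^ 2))) hXinv htangent
  simp only [Pi.sub_apply] at hint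
  rw [integral_sub (integrable_const _) (hX.div_const _), integral_const, integral_div,
    probReal_univ, one_smul] at hint
  calc (1 : ℝ) = Z * (2 / Z - Z / Z ^ 2) := by field_simp; ring
    _ ≤ Z * ∫ x, (X x)⁻¹ ∂μ := by gcongr

lemma integral_abs_div_integral_sub_one_le {X : α → ℝ} (hpos : ∀ x, 0 < X x) (hX : MemLp X 2 μ)
    (hXinv : MemLp (fun x => (X x)⁻¹) 2 μ) :
    ∫ x, |X x / (∫ y, X y ∂μ) - 1| ∂μ ≤
      √((∫ x, X x ^ 2 ∂μ) * (∫ x, (X x)⁻¹ ^ 2 ∂μ) - 1) := by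
  set Z := ∫ x, X x ∂μ
  set W := ∫ x, (X x)⁻¹ ∂μ
  have hZW : 1 ≤ Z * W :=
    one_le_integral_mul_integral_inv hpos (hX.integrable one_le_two) (hXinv.integrable one_le_two)
  have hZ : Z ≠ 0 := fun h => by norm_num [h] at hZW
  have hY : MemLp (fun x => X x / Z) 2 μ := by simpa only [div_eq_mul_inv] using hX.mul_const Z⁻¹
  have hYint : ∫ x, X x / Z ∂μ = 1 := by rw [integral_div, div_self hZ]
  have hYsq : Var[fun x => X x / Z; μ] = (∫ x, X x ^ 2 ∂μ) / Z ^ 2 - 1 := by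
    rw [variance_eq_sub hY, hYint, ← integral_div]
    simp [div_pow]
  have hinv : 1 / Z ^ 2 ≤ ∫ x, (X x)⁻¹ ^ 2 ∂μ := by
    refine le_trans ?_ (sq_integral_le_integral_sq hXinv)
    rw [div_le_iff₀ (by positivity), ← mul_pow, mul_comm W Z]
    exact one_le_pow₀ hZW
  have habs := integral_abs_sub_integral_le_sqrt_variance hY
  rw [hYint, hYsq] at habs
  refine habs.trans (Real.sqrt_le_sqrt (sub_le_sub_right ?_ 1))
  rw [div_eq_mul_one_div]
  exact mul_le_mul_of_nonneg_left hinv (integral_nonneg fun _ => sq_nonneg _)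

lemma tv_tilted_le_integral_abs {f : α → ℝ} (hf : Integrable (fun x => Real.exp (f x)) μ) :
    tv (μ.tilted f) μ ≤
      ENNReal.ofReal (∫ x, |Real.exp (f x) / (∫ y, Real.exp (f y) ∂μ) - 1| ∂μ) := by
  refine iSup₂_le fun A hA => ENNReal.ofReal_le_ofReal ?_
  set Z := ∫ x, Real.exp (f x) ∂μ
  have htilted : (μ.tilted f).real A = ∫ x in A, Real.exp (f x) / Z ∂μ := by
    rw [measureReal_def, tilted_apply_eq_ofReal_integral' f hA, ENNReal.toReal_ofReal]
    exact integral_nonneg fun _ => div_nonneg (Real.exp_pos _).le (integral_exp_pos hf).le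
  have hsub : (μ.tilted f).real A - μ.real A = ∫ x in A, (Real.exp (f x) / Z - 1) ∂μ := by
    rw [integral_sub (hf.div_const _).integrableOn (integrable_const _), htilted]
    simp
  calc |(μ.tilted f).real A - μ.real A| ≤ ∫ x in A, |Real.exp (f x) / Z - 1| ∂μ :=
        hsub ▸ abs_integral_le_integral_abs
    _ ≤ ∫ x, |Real.exp (f x) / Z - 1| ∂μ :=
        setIntegral_le_integral ((hf.div_const _).sub (integrable_const _)).abs
          (ae_of_all _ fun _ => abs_nonneg _)

lemma integrable_exp_and_tv_tilted_le {f : α → ℝ} (hf : AEMeasurable f μ) {M : ℝ}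
    (hM : ∫⁻ z, ENNReal.ofReal (Real.exp (2 * f z.1 - 2 * f z.2)) ∂(μ.prod μ) ≤
      ENNReal.ofReal M) :
    Integrable (fun x => Real.exp (f x)) μ ∧ tv (μ.tilted f) μ ≤ ENNReal.ofReal (√(M - 1)) := by
  have hf₂ : AEMeasurable (fun x => 2 * f x) μ := by fun_prop
  obtain ⟨hint, hint_inv⟩ := integrable_exp_of_lintegral_prod_exp_sub_ne_top hf₂
    (hM.trans_lt ENNReal.ofReal_lt_top).ne
  have hL2 : MemLp (fun x => Real.exp (f x)) 2 μ := memLp_two_exp hf hint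
  have hL2_inv : MemLp (fun x => (Real.exp (f x))⁻¹) 2 μ := by
    simp only [← Real.exp_neg]
    exact memLp_two_exp hf.neg (by simpa only [Pi.neg_apply, mul_neg] using hint_inv)
  refine ⟨hL2.integrable one_le_two, (tv_tilted_le_integral_abs (hL2.integrable one_le_two)).trans
    (ENNReal.ofReal_le_ofReal ((integral_abs_div_integral_sub_one_le (fun x => Real.exp_pos (f x))
      hL2 hL2_inv).trans (Real.sqrt_le_sqrt (sub_le_sub_right ?_ 1))))⟩
  have hsq : ∀ x, Real.exp (f x) ^ 2 = Real.exp (2 * f x) := fun x => by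
    rw [← Real.exp_nat_mul, Nat.cast_ofNat]
  have hsq_inv : ∀ x, (Real.exp (f x))⁻¹ ^ 2 = Real.exp (-(2 * f x)) := fun x => by
    rw [inv_pow, hsq, Real.exp_neg]
  simp only [hsq, hsq_inv]
  rw [lintegral_prod_exp_sub hf₂,
    ← ofReal_integral_eq_lintegral_ofReal hint (ae_of_all _ fun _ => (Real.exp_pos _).le),
    ← ofReal_integral_eq_lintegral_ofReal hint_inv (ae_of_all _ fun _ => (Real.exp_pos _).le),
    ← ENNReal.ofReal_mul (integral_exp_pos hint).le, ENNReal.ofReal_le_ofReal_iff'] at hM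
  exact hM.resolve_right (mul_pos (integral_exp_pos hint) (integral_exp_pos hint_inv)).not_ge

lemma lintegral_cond_prod_cond (γ : Measure α) [SFinite γ] (B : Set α) (F : α × α → ℝ≥0∞) :
    ∫⁻ z, F z ∂(γ[|B].prod γ[|B]) = (γ B)⁻¹ ^ 2 * ∫⁻ z in B ×ˢ B, F z ∂(γ.prod γ) := by
  rw [ProbabilityTheory.cond, Measure.prod_smul_left, Measure.prod_smul_right,
    Measure.prod_restrict, lintegral_smul_measure, lintegral_smul_measure, smul_eq_mul,
    smul_eq_mul, ← mul_assoc, sq]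

theorem tv_normalized_le {γ ν : Measure α} [IsProbabilityMeasure γ] [IsFiniteMeasure ν] [NeZero ν]
    {B : Set α} (hB : MeasurableSet B) (hγB : γ B ≠ 0) {f : α → ℝ}
    (hf : AEMeasurable f (γ.restrict B)) {c : ℝ≥0∞} (hc : c ≠ 0) (hc' : c ≠ ∞)
    (hν : ν.restrict B = c • (γ.restrict B).withDensity fun x => ENNReal.ofReal (Real.exp (f x)))
    {M : ℝ}
    (hM : ∫⁻ z in B ×ˢ B, ENNReal.ofReal (Real.exp (2 * f z.1 - 2 * f z.2)) ∂(γ.prod γ) ≤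
      ENNReal.ofReal M) :
    tv ν[|.univ] γ ≤ ν Bᶜ / ν .univ + ENNReal.ofReal (√(M / γ.real B ^ 2 - 1)) + γ Bᶜ := by
  have hγB_pos : 0 < γ.real B := ENNReal.toReal_pos hγB (measure_ne_top _ _)
  have : IsProbabilityMeasure γ[|B] := cond_isProbabilityMeasure hγB
  have : IsProbabilityMeasure ν[|.univ] :=
    cond_isProbabilityMeasure (NeZero.ne _)
  have hM_cond : ∫⁻ z, ENNReal.ofReal (Real.exp (2 * f z.1 - 2 * f z.2)) ∂(γ[|B].prod γ[|B]) ≤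
      ENNReal.ofReal (M / γ.real B ^ 2) := by
    rw [lintegral_cond_prod_cond, div_eq_inv_mul, ENNReal.ofReal_mul (by positivity), ← inv_pow,
      ENNReal.ofReal_pow (by positivity), ENNReal.ofReal_inv_of_pos hγB_pos, ofReal_measureReal]
    gcongr
  obtain ⟨hint, htilted⟩ := integrable_exp_and_tv_tilted_le (μ := γ[|B]) (hf.smul_measure _) hM_cond
  have hcond : ν[|.univ][|B] = γ[|B].tilted f := by
    rw [cond_cond_eq_cond_inter' .univ hB (measure_ne_top _ _), Set.univ_inter,
      cond_eq_tilted hγB hc hc' hν hint]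
  calc tv ν[|.univ] γ
      ≤ tv ν[|.univ] ν[|.univ][|B] + tv (γ[|B].tilted f) γ[|B] + tv γ[|B] γ := by
        rw [← hcond, add_assoc]
        exact (tv_triangle _ _ _).trans (by gcongr; exact tv_triangle _ _ _)
    _ ≤ ν[|.univ] Bᶜ + ENNReal.ofReal (√(M / γ.real B ^ 2 - 1)) + γ Bᶜ := by
        rw [tv_comm γ[|B]]
        gcongr
        exacts [tv_cond_le _ hB, tv_cond_le _ hB]
    _ = _ := by rw [cond_apply .univ, Set.univ_inter, ENNReal.div_eq_inv_mul]

end ChiSquare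

section MaureyPisier
open scoped RealInnerProductSpace ENNReal

lemma exp_intervalIntegral_le {f : ℝ → ℝ} {a : ℝ} (ha : 0 < a)
    (hf : ContinuousOn f (Set.Icc 0 a)) :
    ENNReal.ofReal (Real.exp (∫ t in (0 : ℝ)..a, f t)) ≤
      ENNReal.ofReal a⁻¹ * ∫⁻ t in Set.Icc 0 a, ENNReal.ofReal (Real.exp (a * f t)) := by
  have hvol : volume.real (Set.Icc (0 : ℝ) a) = a := by simp [ha.le]
  have hcont : ContinuousOn (fun t => a * f t) (Set.Icc 0 a) := continuousOn_const.mul hf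
  have hexp : IntegrableOn (fun t => Real.exp (a * f t)) (Set.Icc 0 a) volume :=
    (Real.continuous_exp.comp_continuousOn hcont).integrableOn_Icc
  have hjensen := convexOn_exp.map_set_average_le Real.continuous_exp.continuousOn isClosed_univ
    (t := Set.Icc 0 a) (μ := volume) (f := fun t => a * f t) (by simp [ha]) (by simp)
    (by simp) hcont.integrableOn_Icc hexp
  rw [setAverage_eq, setAverage_eq, hvol, integral_const_mul, smul_eq_mul, smul_eq_mul,
    inv_mul_cancel_left₀ ha.ne', integral_Icc_eq_integral_Ioc,
    ← intervalIntegral.integral_of_le ha.le] at hjensen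
  refine (ENNReal.ofReal_le_ofReal hjensen).trans_eq ?_
  rw [ENNReal.ofReal_mul (by positivity),
    ofReal_integral_eq_lintegral_ofReal hexp (ae_of_all _ fun _ => (Real.exp_pos _).le)]

variable {E : Type*} [NormedAddCommGroup E] [NormedSpace ℝ E]

lemma norm_cos_smul_add_sin_smul_le {x y : E} {R : ℝ} (hx : ‖x‖ ≤ R) (hy : ‖y‖ ≤ R) (t : ℝ) :
    ‖Real.cos t • x + Real.sin t • y‖ ≤ √2 * R := by
  have hR : 0 ≤ R := (norm_nonneg x).trans hx
  calc _ ≤ |Real.cos t| * R + |Real.sin t| * R := by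
        refine (norm_add_le _ _).trans ?_
        simp only [norm_smul, Real.norm_eq_abs]
        gcongr
    _ = (|Real.cos t| + |Real.sin t|) * R := by ring
    _ ≤ _ := by
        gcongr
        apply Real.le_sqrt_of_sq_le
        nlinarith [sq_abs (Real.cos t), sq_abs (Real.sin t), Real.sin_sq_add_cos_sq t,
          sq_nonneg (|Real.cos t| - |Real.sin t|)]

lemma exp_sub_le_lintegral_rotation {G : E → ℝ} {G' : E → StrongDual ℝ E} {R : ℝ}
    (hG : ∀ x ∈ Metric.closedBall (0 : E) (√2 * R), HasFDerivAt G (G' x) x)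
    (hG' : ContinuousOn G' (Metric.closedBall 0 (√2 * R))) {x y : E} (hx : ‖x‖ ≤ R)
    (hy : ‖y‖ ≤ R) :
    ENNReal.ofReal (Real.exp (G y - G x)) ≤ ENNReal.ofReal (Real.pi / 2)⁻¹ *
      ∫⁻ t in Set.Icc 0 (Real.pi / 2), ENNReal.ofReal (Real.exp (Real.pi / 2 *
        G' (Real.cos t • x + Real.sin t • y) (-Real.sin t • x + Real.cos t • y))) := by
  have hmem : ∀ t, Real.cos t • x + Real.sin t • y ∈ Metric.closedBall (0 : E) (√2 * R) :=
    fun t => by simpa using norm_cos_smul_add_sin_smul_le hx hy t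
  have hcont : Continuous fun t =>
      G' (Real.cos t • x + Real.sin t • y) (-Real.sin t • x + Real.cos t • y) :=
    (hG'.comp_continuous (by fun_prop) hmem).clm_apply (by fun_prop)
  have hpath : ∀ t, HasDerivAt (fun t => Real.cos t • x + Real.sin t • y)
      (-Real.sin t • x + Real.cos t • y) t := fun t =>
    ((Real.hasDerivAt_cos t).smul_const x).add ((Real.hasDerivAt_sin t).smul_const y)
  have hint := intervalIntegral.integral_eq_sub_of_hasDerivAt (a := 0) (b := Real.pi / 2)
    (fun t _ => (hG _ (hmem t)).comp_hasDerivAt t (hpath t)) (hcont.intervalIntegrable _ _)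
  simp only [Function.comp_apply, Real.cos_pi_div_two, Real.sin_pi_div_two, Real.cos_zero,
    Real.sin_zero, zero_smul, one_smul, zero_add, add_zero] at hint
  rw [← hint]
  exact exp_intervalIntegral_le (by positivity) hcont.continuousOn

end MaureyPisier

section StdGaussian
open scoped RealInnerProductSpace ENNReal
variable {E : Type*} [NormedAddCommGroup E] [InnerProductSpace ℝ E] [FiniteDimensional ℝ E]
  [MeasurableSpace E] [BorelSpace E]

lemma lintegral_exp_strongDual_stdGaussian (φ : StrongDual ℝ E) :
    ∫⁻ y, ENNReal.ofReal (Real.exp (φ y)) ∂stdGaussian E =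
      ENNReal.ofReal (Real.exp (‖φ‖ ^ 2 / 2)) := by
  have hmap := IsGaussian.map_eq_gaussianReal (μ := stdGaussian E) φ
  rw [integral_strongDual_stdGaussian, variance_dual_stdGaussian] at hmap
  have hint : Integrable (fun y => Real.exp (φ y)) (stdGaussian E) := by
    have : Integrable (fun x : ℝ => Real.exp (1 * x)) ((stdGaussian E).map φ) := by
      rw [hmap]
      exact integrable_exp_mul_gaussianReal 1
    simpa [Function.comp_def] using this.comp_measurable (by fun_prop)
  rw [← ofReal_integral_eq_lintegral_ofReal hint (ae_of_all _ fun _ => (Real.exp_pos _).le)]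
  congr 1
  simpa [mgf, Real.toNNReal_of_nonneg] using mgf_gaussianReal hmap 1

lemma lintegral_exp_mul_strongDual_stdGaussian (c : ℝ) (φ : StrongDual ℝ E) :
    ∫⁻ y, ENNReal.ofReal (Real.exp (c * φ y)) ∂stdGaussian E =
      ENNReal.ofReal (Real.exp (c ^ 2 / 2 * ‖φ‖ ^ 2)) := by
  have h := lintegral_exp_strongDual_stdGaussian (c • φ)
  rw [norm_smul, mul_pow, Real.norm_eq_abs, sq_abs] at h
  simpa only [smul_apply, smul_eq_mul, div_mul_eq_mul_div] using h

lemma lintegral_rotation (t : ℝ) {F : E × E → ℝ≥0∞} (hF : Measurable F) :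
    ∫⁻ z, F (Real.cos t • z.1 + Real.sin t • z.2, -Real.sin t • z.1 + Real.cos t • z.2)
      ∂((stdGaussian E).prod (stdGaussian E)) =
      ∫⁻ z, F z ∂((stdGaussian E).prod (stdGaussian E)) := by
  conv_rhs => rw [← IsGaussian.map_rotation_eq_self (μ := stdGaussian E) (by simp) t]
  rw [lintegral_map hF (by fun_prop)]
  simp [ContinuousLinearMap.rotation_apply]

lemma lintegral_average_rotation {F : E × E → ℝ≥0∞} (hF : Measurable F) :
    ∫⁻ z, ENNReal.ofReal (Real.pi / 2)⁻¹ * ∫⁻ t in Set.Icc 0 (Real.pi / 2),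
        F (Real.cos t • z.1 + Real.sin t • z.2, -Real.sin t • z.1 + Real.cos t • z.2)
        ∂volume ∂((stdGaussian E).prod (stdGaussian E)) =
      ∫⁻ z, F z ∂((stdGaussian E).prod (stdGaussian E)) := by
  have hmeas : Measurable (Function.uncurry fun (z : E × E) (t : ℝ) =>
      F (Real.cos t • z.1 + Real.sin t • z.2, -Real.sin t • z.1 + Real.cos t • z.2)) :=
    hF.comp (by fun_prop)
  rw [lintegral_const_mul _ hmeas.lintegral_prod_right, lintegral_lintegral_swap hmeas.aemeasurable]
  simp_rw [lintegral_rotation _ hF]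
  rw [setLIntegral_const, mul_comm, mul_assoc, Real.volume_Icc, sub_zero,
    ← ENNReal.ofReal_mul (by positivity), mul_inv_cancel₀ (by positivity), ENNReal.ofReal_one,
    mul_one]

/-- A truncated Maurey–Pisier inequality: the rotations of a pair of points of the ball of radius
`R` stay in the ball of radius `√2 * R`, so that no global bound of the derivative is needed. -/
lemma lintegral_exp_sub_le {G : E → ℝ} {G' : E → StrongDual ℝ E} {R : ℝ}
    (hG : ∀ x ∈ Metric.closedBall (0 : E) (√2 * R), HasFDerivAt G (G' x) x)
    (hG' : ContinuousOn G' (Metric.closedBall 0 (√2 * R))) :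
    ∫⁻ z in Metric.closedBall (0 : E) R ×ˢ Metric.closedBall (0 : E) R,
        ENNReal.ofReal (Real.exp (G z.2 - G z.1)) ∂((stdGaussian E).prod (stdGaussian E)) ≤
      ∫⁻ x in Metric.closedBall (0 : E) (√2 * R),
        ENNReal.ofReal (Real.exp (Real.pi ^ 2 / 8 * ‖G' x‖ ^ 2)) ∂stdGaussian E := by
  set B := Metric.closedBall (0 : E) (√2 * R)
  have hB : MeasurableSet B := Metric.isClosed_closedBall.measurableSet
  set Φ : E × E → ℝ≥0∞ := (B ×ˢ Set.univ).indicator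
    fun z => ENNReal.ofReal (Real.exp (Real.pi / 2 * G' z.1 z.2)) with hΦ_def
  have hΦ : Measurable Φ := by
    classical
    have hcont : ContinuousOn (fun z : E × E => G' z.1 z.2) (B ×ˢ Set.univ) :=
      (hG'.comp continuousOn_fst fun z hz => hz.1).clm_apply continuousOn_snd
    rw [hΦ_def, ← Set.piecewise_eq_indicator]
    exact (ENNReal.continuous_ofReal.comp_continuousOn (Real.continuous_exp.comp_continuousOn
      (hcont.const_mul _))).measurable_piecewise continuousOn_const (hB.prod .univ)
  have hpointwise : ∀ z ∈ Metric.closedBall (0 : E) R ×ˢ Metric.closedBall (0 : E) R,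
      ENNReal.ofReal (Real.exp (G z.2 - G z.1)) ≤
        ENNReal.ofReal (Real.pi / 2)⁻¹ * ∫⁻ t in Set.Icc 0 (Real.pi / 2),
          Φ (Real.cos t • z.1 + Real.sin t • z.2, -Real.sin t • z.1 + Real.cos t • z.2) := by
    rintro z ⟨hz₁, hz₂⟩
    rw [mem_closedBall_zero_iff] at hz₁ hz₂
    have hmem : ∀ t, Real.cos t • z.1 + Real.sin t • z.2 ∈ B := fun t =>
      mem_closedBall_zero_iff.2 (norm_cos_smul_add_sin_smul_le hz₁ hz₂ t)
    simpa [Φ, hmem] using exp_sub_le_lintegral_rotation hG hG' hz₁ hz₂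
  have hinner : ∀ x, ∫⁻ y, Φ (x, y) ∂stdGaussian E = B.indicator
      (fun x => ENNReal.ofReal (Real.exp (Real.pi ^ 2 / 8 * ‖G' x‖ ^ 2))) x := fun x => by
    by_cases hx : x ∈ B
    · simp only [Φ, Set.indicator, Set.mem_prod, hx, Set.mem_univ, and_self, if_true,
        lintegral_exp_mul_strongDual_stdGaussian]
      ring_nf
    · simp [Φ, hx]
  calc _ ≤ ∫⁻ z, Φ z ∂((stdGaussian E).prod (stdGaussian E)) := by
        rw [← lintegral_average_rotation hΦ]
        exact (setLIntegral_mono' (Metric.isClosed_closedBall.measurableSet.prod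
          Metric.isClosed_closedBall.measurableSet) hpointwise).trans
            (setLIntegral_le_lintegral _ _)
    _ = _ := by
        rw [lintegral_prod _ hΦ.aemeasurable, ← lintegral_indicator hB]
        simp_rw [hinner]

lemma lintegral_exp_neg_mul_sq_norm {b : ℝ} (hb : 0 < b) :
    ∫⁻ x : E, ENNReal.ofReal (Real.exp (-b * ‖x‖ ^ 2)) =
      ENNReal.ofReal ((Real.pi / b) ^ (Module.finrank ℝ E / 2 : ℝ)) := by
  rw [← GaussianFourier.integral_rexp_neg_mul_sq_norm (V := E) hb,
    ofReal_integral_eq_lintegral_ofReal _ (ae_of_all _ fun _ => (Real.exp_pos _).le)]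
  have hint := GaussianFourier.integrable_cexp_neg_mul_sq_norm_add (V := E) (b := b) (by simpa) 0 0
  refine hint.norm.congr (ae_of_all _ fun x => ?_)
  simp only [Complex.norm_exp]
  norm_num [← Complex.ofReal_pow, ← Complex.ofReal_mul, ← Complex.ofReal_neg]

lemma integral_gaussianDensity_mul_cexp_inner (t : E) :
    ∫ x : E, (((2 * Real.pi) ^ (-(Module.finrank ℝ E / 2 : ℝ)) : ℝ) : ℂ) *
        Complex.exp (-(1 / 2) * ‖x‖ ^ 2 + Complex.I * ⟪t, x⟫) = Complex.exp (-‖t‖ ^ 2 / 2) := by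
  have hpi : ((Real.pi : ℂ) / (1 / 2)) ^ (Module.finrank ℝ E / 2 : ℂ) =
      (((2 * Real.pi) ^ (Module.finrank ℝ E / 2 : ℝ) : ℝ) : ℂ) := by
    rw [Complex.ofReal_cpow (by positivity)]
    push_cast
    congr 1
    ring
  rw [integral_const_mul, GaussianFourier.integral_cexp_neg_mul_sq_norm_add (b := (1 / 2 : ℂ))
    (by norm_num) Complex.I t, hpi, ← mul_assoc, ← Complex.ofReal_mul,
    ← Real.rpow_add (by positivity), Complex.I_sq]
  norm_num

lemma stdGaussian_eq_withDensity : stdGaussian E = volume.withDensity fun x =>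
    ENNReal.ofReal ((2 * Real.pi) ^ (-(Module.finrank ℝ E / 2 : ℝ)) *
      Real.exp (-(1 / 2) * ‖x‖ ^ 2)) := by
  have hfin : IsFiniteMeasure ((volume : Measure E).withDensity fun x =>
      ENNReal.ofReal ((2 * Real.pi) ^ (-(Module.finrank ℝ E / 2 : ℝ)) *
      Real.exp (-(1 / 2) * ‖x‖ ^ 2))) := by
    refine isFiniteMeasure_withDensity ?_
    have hconst : 0 ≤ (2 * Real.pi) ^ (-(Module.finrank ℝ E / 2 : ℝ)) := by positivity
    simp_rw [ENNReal.ofReal_mul hconst]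
    rw [lintegral_const_mul _ (by fun_prop), lintegral_exp_neg_mul_sq_norm (by norm_num)]
    exact ENNReal.mul_ne_top ENNReal.ofReal_ne_top ENNReal.ofReal_ne_top
  refine Measure.ext_of_charFun (funext fun t => ?_)
  rw [charFun_stdGaussian, charFun_apply,
    integral_withDensity_eq_integral_toReal_smul (by fun_prop) (by simp),
    ← integral_gaussianDensity_mul_cexp_inner t]
  refine integral_congr_ae (ae_of_all _ fun x => ?_)
  simp only
  rw [ENNReal.toReal_ofReal (by positivity), Complex.real_smul, Complex.exp_add, real_inner_comm]
  push_cast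
  ring_nf

lemma lintegral_exp_mul_sq_norm_stdGaussian {c : ℝ} (hc : c < 1 / 2) :
    ∫⁻ x, ENNReal.ofReal (Real.exp (c * ‖x‖ ^ 2)) ∂stdGaussian E =
      ENNReal.ofReal ((1 - 2 * c) ^ (-(Module.finrank ℝ E / 2 : ℝ))) := by
  have hdensity : ∀ x : E, ENNReal.ofReal ((2 * Real.pi) ^ (-(Module.finrank ℝ E / 2 : ℝ)) *
      Real.exp (-(1 / 2) * ‖x‖ ^ 2)) * ENNReal.ofReal (Real.exp (c * ‖x‖ ^ 2)) =
      ENNReal.ofReal ((2 * Real.pi) ^ (-(Module.finrank ℝ E / 2 : ℝ))) *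
      ENNReal.ofReal (Real.exp (-(1 / 2 - c) * ‖x‖ ^ 2)) := fun x => by
    rw [← ENNReal.ofReal_mul (by positivity), ← ENNReal.ofReal_mul (by positivity), mul_assoc,
      ← Real.exp_add]
    ring_nf
  have hquot : Real.pi / (1 / 2 - c) = (2 * Real.pi) * (1 - 2 * c)⁻¹ := by
    have : 1 / 2 - c ≠ 0 := by linarith
    have : 1 - 2 * c ≠ 0 := by linarith
    field_simp
  have hnonneg : 0 ≤ (1 - 2 * c)⁻¹ := inv_nonneg.2 (by linarith)
  rw [stdGaussian_eq_withDensity, lintegral_withDensity_eq_lintegral_mul _ (by fun_prop)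
    (by fun_prop)]
  simp only [Pi.mul_apply, hdensity]
  rw [lintegral_const_mul _ (by fun_prop), lintegral_exp_neg_mul_sq_norm (by linarith),
    ← ENNReal.ofReal_mul (by positivity), hquot, Real.mul_rpow (by positivity) hnonneg, ← mul_assoc,
    ← Real.rpow_add (by positivity), Real.inv_rpow (by linarith), ← Real.rpow_neg (by linarith),
    neg_add_cancel, Real.rpow_zero, one_mul]

lemma one_sub_rpow_neg_half_le {c r : ℝ} (hc₀ : 0 ≤ c) (hc : c ≤ 1 / 4) (hr : 0 ≤ r) :
    (1 - 2 * c) ^ (-(r / 2)) ≤ Real.exp (2 * c * r) := by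
  have hpos : 0 < 1 - 2 * c := by linarith
  have hinv : (1 - 2 * c)⁻¹ ≤ 1 + 4 * c := by
    rw [inv_le_iff_one_le_mul₀ hpos]
    nlinarith
  have hlog : -(4 * c) ≤ Real.log (1 - 2 * c) := by
    linarith [Real.one_sub_inv_le_log_of_pos hpos]
  rw [Real.rpow_def_of_pos hpos]
  exact Real.exp_le_exp.2 (by nlinarith)

lemma lintegral_exp_mul_sq_norm_stdGaussian_le {c : ℝ} (hc₀ : 0 ≤ c) (hc : c ≤ 1 / 4) :
    ∫⁻ x, ENNReal.ofReal (Real.exp (c * ‖x‖ ^ 2)) ∂stdGaussian E ≤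
      ENNReal.ofReal (Real.exp (2 * c * Module.finrank ℝ E)) := by
  rw [lintegral_exp_mul_sq_norm_stdGaussian (by linarith)]
  exact ENNReal.ofReal_le_ofReal (one_sub_rpow_neg_half_le hc₀ hc (Nat.cast_nonneg _))

lemma stdGaussian_closedBall_compl_le {R : ℝ} (hR : 0 ≤ R) :
    stdGaussian E (Metric.closedBall 0 R)ᶜ ≤
      ENNReal.ofReal (Real.exp (Module.finrank ℝ E / 2 - R ^ 2 / 4)) := by
  have hsub : (Metric.closedBall (0 : E) R)ᶜ ⊆ {x | ENNReal.ofReal (Real.exp (1 / 4 * R ^ 2)) ≤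
      ENNReal.ofReal (Real.exp (1 / 4 * ‖x‖ ^ 2))} := fun x hx => by
    rw [Set.mem_compl_iff, mem_closedBall_zero_iff, not_le] at hx
    rw [Set.mem_ofPred_eq]
    gcongr
  calc stdGaussian E (Metric.closedBall 0 R)ᶜ
      ≤ (∫⁻ x, ENNReal.ofReal (Real.exp (1 / 4 * ‖x‖ ^ 2)) ∂stdGaussian E) /
          ENNReal.ofReal (Real.exp (1 / 4 * R ^ 2)) :=
        (measure_mono hsub).trans (meas_ge_le_lintegral_div (by fun_prop)
          (by simp [Real.exp_pos]) ENNReal.ofReal_ne_top)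
    _ ≤ ENNReal.ofReal (Real.exp (2 * (1 / 4) * Module.finrank ℝ E)) /
          ENNReal.ofReal (Real.exp (1 / 4 * R ^ 2)) := by
        gcongr
        exact lintegral_exp_mul_sq_norm_stdGaussian_le (by norm_num) le_rfl
    _ = ENNReal.ofReal (Real.exp (Module.finrank ℝ E / 2 - R ^ 2 / 4)) := by
        rw [← ENNReal.ofReal_div_of_pos (Real.exp_pos _), ← Real.exp_sub]
        ring_nf

lemma lintegral_exp_two_mul_sub_le {f : E → ℝ} {f' : E → StrongDual ℝ E} {R a b : ℝ}
    (hf : ∀ x ∈ Metric.closedBall (0 : E) (√2 * R), HasFDerivAt f (f' x) x)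
    (hf' : ContinuousOn f' (Metric.closedBall 0 (√2 * R))) (ha : 40 * a ^ 2 ≤ 1)
    (hbound : ∀ x ∈ Metric.closedBall (0 : E) (√2 * R), ‖f' x‖ ≤ a * ‖x‖ + b) :
    ∫⁻ z in Metric.closedBall (0 : E) R ×ˢ Metric.closedBall (0 : E) R,
        ENNReal.ofReal (Real.exp (2 * f z.1 - 2 * f z.2))
          ∂((stdGaussian E).prod (stdGaussian E)) ≤
      ENNReal.ofReal (Real.exp (20 * a ^ 2 * Module.finrank ℝ E + 10 * b ^ 2)) := by
  have hpi : Real.pi ^ 2 ≤ 10 := by nlinarith [Real.pi_lt_d2, Real.pi_pos]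
  have hnorm : ∀ x ∈ Metric.closedBall (0 : E) (√2 * R),
      Real.pi ^ 2 / 8 * ‖(-2 : ℝ) • f' x‖ ^ 2 ≤ 10 * b ^ 2 + 10 * a ^ 2 * ‖x‖ ^ 2 := fun x hx => by
    have hsq : ‖f' x‖ ^ 2 ≤ 2 * (b ^ 2 + a ^ 2 * ‖x‖ ^ 2) :=
      calc ‖f' x‖ ^ 2 ≤ (a * ‖x‖ + b) ^ 2 := pow_le_pow_left₀ (norm_nonneg _) (hbound x hx) 2
        _ ≤ 2 * (b ^ 2 + a ^ 2 * ‖x‖ ^ 2) := by nlinarith [sq_nonneg (a * ‖x‖ - b)]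
    calc Real.pi ^ 2 / 8 * ‖(-2 : ℝ) • f' x‖ ^ 2 = Real.pi ^ 2 * (‖f' x‖ ^ 2 / 2) := by
          rw [norm_smul, mul_pow]
          norm_num
          ring
      _ ≤ 10 * (2 * (b ^ 2 + a ^ 2 * ‖x‖ ^ 2) / 2) := by gcongr
      _ = 10 * b ^ 2 + 10 * a ^ 2 * ‖x‖ ^ 2 := by ring
  calc _ = ∫⁻ z in Metric.closedBall (0 : E) R ×ˢ Metric.closedBall (0 : E) R,
        ENNReal.ofReal (Real.exp (-2 * f z.2 - -2 * f z.1))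
          ∂((stdGaussian E).prod (stdGaussian E)) := by
        refine lintegral_congr fun z => ?_
        ring_nf
    _ ≤ ∫⁻ x in Metric.closedBall (0 : E) (√2 * R),
        ENNReal.ofReal (Real.exp (Real.pi ^ 2 / 8 * ‖(-2 : ℝ) • f' x‖ ^ 2)) ∂stdGaussian E :=
        lintegral_exp_sub_le (fun x hx => (hf x hx).const_mul (-2)) (hf'.fun_const_smul (-2))
    _ ≤ ∫⁻ x in Metric.closedBall (0 : E) (√2 * R), ENNReal.ofReal (Real.exp (10 * b ^ 2)) *
        ENNReal.ofReal (Real.exp (10 * a ^ 2 * ‖x‖ ^ 2)) ∂stdGaussian E := by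
        refine setLIntegral_mono' Metric.isClosed_closedBall.measurableSet fun x hx => ?_
        rw [← ENNReal.ofReal_mul (Real.exp_pos _).le, ← Real.exp_add]
        exact ENNReal.ofReal_le_ofReal (Real.exp_le_exp.2 (hnorm x hx))
    _ ≤ ENNReal.ofReal (Real.exp (10 * b ^ 2)) *
        ENNReal.ofReal (Real.exp (2 * (10 * a ^ 2) * Module.finrank ℝ E)) := by
        rw [lintegral_const_mul _ (by fun_prop)]
        gcongr
        exact (setLIntegral_le_lintegral _ _).trans
          (lintegral_exp_mul_sq_norm_stdGaussian_le (by positivity) (by linarith))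
    _ = _ := by
        rw [← ENNReal.ofReal_mul (Real.exp_pos _).le, ← Real.exp_add]
        ring_nf

end StdGaussian

section Geometry
open scoped RealInnerProductSpace MatrixOrder
variable {d : ℕ} {θ θ' : EuclideanSpace ℝ (Fin d)}

/-- The variation `(-∑ⱼ uⱼ, u₁, …, u_d)` of the full vector of probabilities in direction `u`. -/
def tangent (u : EuclideanSpace ℝ (Fin d)) : Fin (d + 1) → ℝ :=
  Fin.cons (-∑ j, u j) (fun j => u j)

lemma sum_tangent (u : EuclideanSpace ℝ (Fin d)) : ∑ j, tangent u j = 0 := by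
  simp [tangent, Fin.sum_univ_succ]

lemma sum_full (θ : EuclideanSpace ℝ (Fin d)) : ∑ j, full θ j = 1 := by
  simp [full, Fin.sum_univ_succ]

lemma full_add (θ u : EuclideanSpace ℝ (Fin d)) (j : Fin (d + 1)) :
    full (θ + u) j = full θ j + tangent u j := by
  refine Fin.cases ?_ (fun i => ?_) j
  · simp only [full, tangent, Fin.cons_zero, PiLp.add_apply, Finset.sum_add_distrib]
    ring
  · simp [full, tangent]

lemma tangent_sub (θ θ' : EuclideanSpace ℝ (Fin d)) (j : Fin (d + 1)) :
    tangent (θ - θ') j = full θ j - full θ' j := by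
  rw [eq_sub_iff_add_eq', ← full_add, add_sub_cancel]

lemma tangent_add (u v : EuclideanSpace ℝ (Fin d)) (j : Fin (d + 1)) :
    tangent (u + v) j = tangent u j + tangent v j := by
  have h := full_add 0 (u + v) j
  rw [← add_assoc, full_add, full_add] at h
  linarith

lemma tangent_smul (c : ℝ) (u : EuclideanSpace ℝ (Fin d)) (j : Fin (d + 1)) :
    tangent (c • u) j = c * tangent u j := by
  refine Fin.cases ?_ (fun i => ?_) j
  · simp [tangent, Finset.mul_sum]
  · simp [tangent]

lemma mem_paramSpace_iff : θ ∈ paramSpace d ↔ ∀ j, 0 < full θ j := by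
  simp [paramSpace, full, Fin.forall_fin_succ, and_comm]

lemma full_pos (hθ : θ ∈ paramSpace d) (j : Fin (d + 1)) : 0 < full θ j :=
  mem_paramSpace_iff.1 hθ j

lemma minProb_le (θ : EuclideanSpace ℝ (Fin d)) (j : Fin (d + 1)) : minProb θ ≤ full θ j :=
  ciInf_le (Set.finite_range _).bddBelow j

lemma minProb_pos (hθ : θ ∈ paramSpace d) : 0 < minProb θ := by
  obtain ⟨j, hj⟩ := exists_eq_ciInf_of_finite (f := full θ)
  exact (full_pos hθ j).trans_eq hj

/-- The inner product `⟨u, F v⟩` given by the Fisher information matrix `F` at `θ`. -/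
noncomputable def fisherInner (θ u v : EuclideanSpace ℝ (Fin d)) : ℝ :=
  ∑ j, tangent u j * tangent v j / full θ j

lemma dotProduct_fisher_mulVec (θ u v : EuclideanSpace ℝ (Fin d)) :
    u.ofLp ⬝ᵥ (fisher θ).mulVec v.ofLp = fisherInner θ u v := by
  unfold fisher fisherInner
  rw [Matrix.add_mulVec, dotProduct_add, Fin.sum_univ_succ, add_comm]
  congr 1
  · simp only [dotProduct, Matrix.mulVec, Matrix.of_apply, tangent, Fin.cons_zero]
    rw [← Finset.mul_sum, ← Finset.sum_mul]
    ring
  · simp only [dotProduct, Matrix.mulVec_diagonal, tangent, Fin.cons_succ, full]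
    exact Finset.sum_congr rfl fun i _ => by ring

lemma wnorm_fisher (θ u : EuclideanSpace ℝ (Fin d)) :
    wnorm (fisher θ) u = √(fisherInner θ u u) := by
  rw [wnorm, dotProduct_fisher_mulVec]

lemma fisherInner_self_nonneg (hθ : θ ∈ paramSpace d) (u : EuclideanSpace ℝ (Fin d)) :
    0 ≤ fisherInner θ u u :=
  Finset.sum_nonneg fun j _ => div_nonneg (mul_self_nonneg _) (full_pos hθ j).le

lemma fisherInner_self_pos (hθ : θ ∈ paramSpace d) {u : EuclideanSpace ℝ (Fin d)} (hu : u ≠ 0) :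
    0 < fisherInner θ u u := by
  obtain ⟨i, hi⟩ : ∃ i, u i ≠ 0 := by
    contrapose! hu
    exact PiLp.ext hu
  refine Finset.sum_pos' (fun j _ => div_nonneg (mul_self_nonneg _) (full_pos hθ j).le)
    ⟨i.succ, Finset.mem_univ _, div_pos (mul_self_pos.2 ?_) (full_pos hθ _)⟩
  simpa [tangent] using hi

lemma abs_tangent_le (hθ : θ ∈ paramSpace d) (u : EuclideanSpace ℝ (Fin d)) (j : Fin (d + 1)) :
    |tangent u j| ≤ full θ j * √(fisherInner θ u u / minProb θ) := by
  have hj := full_pos hθ j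
  have hm := minProb_pos hθ
  have hterm : tangent u j ^ 2 / full θ j ≤ fisherInner θ u u := by
    rw [sq]
    exact Finset.single_le_sum (f := fun j => tangent u j * tangent u j / full θ j)
      (fun i _ => div_nonneg (mul_self_nonneg _) (full_pos hθ i).le) (Finset.mem_univ j)
  rw [← div_le_iff₀' hj]
  nth_rw 1 [← abs_of_pos hj]
  rw [← abs_div]
  refine Real.abs_le_sqrt ?_
  calc (tangent u j / full θ j) ^ 2 = tangent u j ^ 2 / full θ j / full θ j := by
        rw [div_pow, sq (full θ j), div_div]
    _ ≤ fisherInner θ u u / minProb θ :=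
        div_le_div₀ (fisherInner_self_nonneg hθ u) hterm hm (minProb_le θ j)

lemma sum_abs_tangent_mul_le (hθ : θ ∈ paramSpace d) (u v : EuclideanSpace ℝ (Fin d)) :
    ∑ j, |tangent u j| * |tangent v j| / full θ j ≤
      √(fisherInner θ u u) * √(fisherInner θ v v) := by
  have hsq : ∀ w, fisherInner θ w w = ∑ j, (|tangent w j| / √(full θ j)) ^ 2 := fun w =>
    Finset.sum_congr rfl fun j _ => by
      rw [div_pow, sq_abs, Real.sq_sqrt (full_pos hθ j).le, sq]
  rw [hsq u, hsq v]
  refine le_of_eq_of_le (Finset.sum_congr rfl fun j _ => ?_)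
    (Real.sum_mul_le_sqrt_mul_sqrt Finset.univ _ _)
  rw [div_mul_div_comm, Real.mul_self_sqrt (full_pos hθ j).le]

lemma abs_fisherInner_sub_le (hθ : θ ∈ paramSpace d) (hθ' : θ' ∈ paramSpace d) {a : ℝ}
    (ha : ∀ j, |full θ' j - full θ j| ≤ a * full θ' j) (u v : EuclideanSpace ℝ (Fin d)) :
    |fisherInner θ' u v - fisherInner θ u v| ≤
      a * (√(fisherInner θ u u) * √(fisherInner θ v v)) := by
  have ha0 : 0 ≤ a := nonneg_of_mul_nonneg_left ((abs_nonneg _).trans (ha 0)) (full_pos hθ' 0)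
  have hterm : ∀ j, |tangent u j * tangent v j / full θ' j - tangent u j * tangent v j / full θ j| ≤
      a * (|tangent u j| * |tangent v j| / full θ j) := by
    intro j
    have hj := full_pos hθ j
    have hj' := full_pos hθ' j
    calc _ = |tangent u j| * |tangent v j| / full θ j * (|full θ' j - full θ j| / full θ' j) := by
          rw [div_sub_div _ _ hj'.ne' hj.ne', mul_comm (full θ' j), ← mul_sub, abs_div, abs_mul,
            abs_mul, abs_sub_comm, abs_of_pos (mul_pos hj' hj), mul_comm (full θ' j),
            mul_div_mul_comm]
      _ ≤ |tangent u j| * |tangent v j| / full θ j * a := by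
          gcongr
          exact (div_le_iff₀ hj').2 (ha j)
      _ = _ := mul_comm _ _
  rw [fisherInner, fisherInner, ← Finset.sum_sub_distrib]
  calc _ ≤ ∑ j, a * (|tangent u j| * |tangent v j| / full θ j) :=
        (Finset.abs_sum_le_sum_abs _ _).trans (Finset.sum_le_sum fun j _ => hterm j)
    _ ≤ _ := by
        rw [← Finset.mul_sum]
        exact mul_le_mul_of_nonneg_left (sum_abs_tangent_mul_le hθ u v) ha0

lemma posDef_fisher (hθ : θ ∈ paramSpace d) : (fisher θ).PosDef := by
  refine Matrix.PosDef.of_dotProduct_mulVec_pos ?_ fun x hx => ?_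
  · refine (Matrix.isHermitian_diagonal _).add ?_
    ext i j
    simp
  · rw [star_trivial, ← WithLp.ofLp_toLp 2 x, dotProduct_fisher_mulVec]
    exact fisherInner_self_pos hθ fun h => hx (congrArg WithLp.ofLp h)

lemma sqrt_inv_mul_mul_sqrt_inv {m : Type*} [Fintype m] [DecidableEq m] {A : Matrix m m ℝ}
    (hA : A.PosDef) : CFC.sqrt A⁻¹ * A * CFC.sqrt A⁻¹ = 1 := by
  rw [← mul_eq_one_comm, ← mul_assoc, CFC.sqrt_mul_sqrt_self _ hA.inv.posSemidef.nonneg]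
  exact Matrix.nonsing_inv_mul _ (hA.isUnit.map Matrix.detMonoidHom)

/-- Coordinates `x ↦ L x` in which `n` times the Fisher information `F` at `θ` is the identity
matrix, and which turn Gaussian measures with covariance `(n F)⁻¹` into standard ones. -/
structure IsFisherFrame (n : ℝ) (θ : EuclideanSpace ℝ (Fin d))
    (L : EuclideanSpace ℝ (Fin d) ≃L[ℝ] EuclideanSpace ℝ (Fin d)) : Prop where
  mul_fisherInner : ∀ x y, n * fisherInner θ (L x) (L y) = ⟪x, y⟫
  multivariateGaussian_eq_map : ∀ μ, multivariateGaussian μ (n • fisher θ)⁻¹ =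
    (stdGaussian (EuclideanSpace ℝ (Fin d))).map fun x => μ + L x

lemma exists_isFisherFrame (hθ : θ ∈ paramSpace d) {n : ℝ} (hn : 0 < n) :
    ∃ L, IsFisherFrame n θ L := by
  have hP : (n • fisher θ).PosDef := (posDef_fisher hθ).smul hn
  set A := CFC.sqrt (n • fisher θ)⁻¹ with hA
  have hAt : A.transpose = A := by
    have : star A = A := (CFC.sqrt_nonneg _).isSelfAdjoint.star_eq
    rwa [Matrix.star_eq_conjTranspose, Matrix.conjTranspose_eq_transpose_of_trivial] at this
  have hinner : ∀ x y : EuclideanSpace ℝ (Fin d),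
      n * fisherInner θ (Matrix.toEuclideanCLM (𝕜 := ℝ) A x) (Matrix.toEuclideanCLM (𝕜 := ℝ) A y) =
        ⟪x, y⟫ := by
    intro x y
    rw [← dotProduct_fisher_mulVec, ← smul_eq_mul, ← dotProduct_smul, ← Matrix.smul_mulVec,
      Matrix.ofLp_toEuclideanCLM, Matrix.ofLp_toEuclideanCLM, Matrix.mulVec_mulVec,
      ← Matrix.vecMul_transpose, hAt, ← Matrix.dotProduct_mulVec, Matrix.mulVec_mulVec,
      ← mul_assoc, hA, sqrt_inv_mul_mul_sqrt_inv hP, Matrix.one_mulVec, real_inner_comm]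
    rfl
  have hinj : Function.Injective (Matrix.toEuclideanCLM (𝕜 := ℝ) A).toLinearMap := by
    refine (injective_iff_map_eq_zero _).2 fun x hx => ?_
    have h := hinner x x
    rw [show Matrix.toEuclideanCLM (𝕜 := ℝ) A x = 0 from hx, ← dotProduct_fisher_mulVec] at h
    simpa using h.symm
  exact ⟨(LinearEquiv.ofInjectiveEndo _ hinj).toContinuousLinearEquiv, hinner, fun _ => rfl⟩

namespace IsFisherFrame
variable {n : ℝ} {L : EuclideanSpace ℝ (Fin d) ≃L[ℝ] EuclideanSpace ℝ (Fin d)}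

lemma fisherInner_self (h : IsFisherFrame n θ L) (hn : 0 < n) (x : EuclideanSpace ℝ (Fin d)) :
    fisherInner θ (L x) (L x) = ‖x‖ ^ 2 / n := by
  rw [eq_div_iff hn.ne', mul_comm, h.mul_fisherInner, real_inner_self_eq_norm_sq]

lemma wnorm_eq (h : IsFisherFrame n θ L) (hn : 0 < n) (x : EuclideanSpace ℝ (Fin d)) :
    wnorm (fisher θ) (L x) = ‖x‖ / √n := by
  rw [wnorm_fisher, h.fisherInner_self hn, Real.sqrt_div (sq_nonneg _),
    Real.sqrt_sq (norm_nonneg _)]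

lemma abs_tangent_le (h : IsFisherFrame n θ L) (hn : 0 < n) (hθ : θ ∈ paramSpace d)
    (x : EuclideanSpace ℝ (Fin d)) (j : Fin (d + 1)) :
    |tangent (L x) j| ≤ full θ j * (‖x‖ / √(n * minProb θ)) := by
  refine (MultinomialBvM.abs_tangent_le hθ _ j).trans_eq ?_
  rw [h.fisherInner_self hn, div_div, Real.sqrt_div (sq_nonneg _), Real.sqrt_sq (norm_nonneg _)]

lemma abs_fisherInner_sub_le (h : IsFisherFrame n θ L) (hn : 0 < n) (hθ : θ ∈ paramSpace d)
    (hθ' : θ' ∈ paramSpace d) {a : ℝ} (ha : ∀ j, |full θ' j - full θ j| ≤ a * full θ' j)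
    (x y : EuclideanSpace ℝ (Fin d)) :
    |n * fisherInner θ' (L x) (L y) - ⟪x, y⟫| ≤ a * (‖x‖ * ‖y‖) := by
  have hle := MultinomialBvM.abs_fisherInner_sub_le hθ hθ' ha (L x) (L y)
  rw [← wnorm_fisher, ← wnorm_fisher, h.wnorm_eq hn, h.wnorm_eq hn] at hle
  calc _ = n * |fisherInner θ' (L x) (L y) - fisherInner θ (L x) (L y)| := by
        rw [← h.mul_fisherInner, ← mul_sub, abs_mul, abs_of_pos hn]
    _ ≤ n * (a * (‖x‖ / √n * (‖y‖ / √n))) := by gcongr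
    _ = _ := by
        rw [div_mul_div_comm, Real.mul_self_sqrt hn.le]
        field_simp

end IsFisherFrame
end Geometry

section Likelihood
variable {d : ℕ} {p θ : EuclideanSpace ℝ (Fin d)}

/-- The relative entropy `∑ⱼ pⱼ log (pⱼ / θⱼ)`, where the sum includes the state `0`. -/
noncomputable def relEntropy (p θ : EuclideanSpace ℝ (Fin d)) : ℝ :=
  ∑ j, full p j * (Real.log (full p j) - Real.log (full θ j))

lemma one_add_tangent_div (hp : p ∈ paramSpace d) (θ : EuclideanSpace ℝ (Fin d))
    (j : Fin (d + 1)) : 1 + tangent (θ - p) j / full p j = full θ j / full p j := by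
  rw [tangent_sub, sub_div, div_self (full_pos hp j).ne', add_sub_cancel]

lemma relEntropy_eq (hp : p ∈ paramSpace d) (hθ : θ ∈ paramSpace d) :
    relEntropy p θ = ∑ j, full p j *
      (tangent (θ - p) j / full p j - Real.log (1 + tangent (θ - p) j / full p j)) := by
  have hterm : ∀ j, full p j *
      (tangent (θ - p) j / full p j - Real.log (1 + tangent (θ - p) j / full p j)) =
      full p j * (Real.log (full p j) - Real.log (full θ j)) + tangent (θ - p) j := fun j => by
    rw [one_add_tangent_div hp, Real.log_div (full_pos hθ j).ne' (full_pos hp j).ne', mul_sub,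
      mul_div_cancel₀ _ (full_pos hp j).ne']
    ring
  simp_rw [hterm]
  rw [Finset.sum_add_distrib, sum_tangent, add_zero, relEntropy]

lemma full_mul_sub_log_nonneg (hp : p ∈ paramSpace d) (hθ : θ ∈ paramSpace d) (j : Fin (d + 1)) :
    0 ≤ full p j *
      (tangent (θ - p) j / full p j - Real.log (1 + tangent (θ - p) j / full p j)) := by
  have hpos := div_pos (full_pos hθ j) (full_pos hp j)
  rw [← one_add_tangent_div hp] at hpos
  refine mul_nonneg (full_pos hp j).le ?_
  linarith [Real.log_le_sub_one_of_pos hpos]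

lemma relEntropy_nonneg (hp : p ∈ paramSpace d) (hθ : θ ∈ paramSpace d) : 0 ≤ relEntropy p θ := by
  rw [relEntropy_eq hp hθ]
  exact Finset.sum_nonneg fun j _ => full_mul_sub_log_nonneg hp hθ j

lemma eq_of_relEntropy_eq_zero (hp : p ∈ paramSpace d) (hθ : θ ∈ paramSpace d)
    (h : relEntropy p θ = 0) : θ = p := by
  rw [relEntropy_eq hp hθ,
    Finset.sum_eq_zero_iff_of_nonneg fun j _ => full_mul_sub_log_nonneg hp hθ j] at h
  ext i
  have hpi := full_pos hp i.succ
  have hzero := (mul_eq_zero_iff_left hpi.ne').1 (h i.succ (Finset.mem_univ _))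
  rw [one_add_tangent_div hp] at hzero
  have hone : full θ i.succ / full p i.succ = 1 := by
    by_contra hne
    have hlt := Real.log_lt_sub_one_of_pos (div_pos (full_pos hθ i.succ) hpi) hne
    linarith [one_add_tangent_div hp θ i.succ]
  simpa [full] using (div_eq_one_iff_eq hpi.ne').1 hone

lemma sub_log_one_add_le {y : ℝ} (hy : |y| ≤ 1 / 2) : y - Real.log (1 + y) ≤ 2 * y ^ 2 := by
  have hpos : 0 < 1 + y := by linarith [(abs_le.1 hy).1]
  have hlog := Real.one_sub_inv_le_log_of_pos hpos
  have hrat : y - (1 - (1 + y)⁻¹) ≤ 2 * y ^ 2 := by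
    have : y - (1 - (1 + y)⁻¹) = y ^ 2 / (1 + y) := by field_simp; ring
    rw [this, div_le_iff₀ hpos]
    nlinarith [sq_nonneg y, (abs_le.1 hy).1]
  linarith

lemma le_sub_log_one_add {y : ℝ} (hy : |y| ≤ 1 / 2) : y ^ 2 / 6 ≤ y - Real.log (1 + y) := by
  obtain ⟨hlo, hhi⟩ := abs_le.1 hy
  have hpos : 0 < 1 + y := by linarith
  have hlog := Real.log_le_sub_one_of_pos (Real.sqrt_pos.2 hpos)
  rw [Real.log_sqrt hpos.le] at hlog
  have hr : √(1 + y) ≤ 5 / 4 := by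
    rw [Real.sqrt_le_left (by norm_num)]
    linarith
  have hr0 := Real.sqrt_nonneg (1 + y)
  have hy' : y = √(1 + y) ^ 2 - 1 := by rw [Real.sq_sqrt hpos.le, add_sub_cancel_left]
  -- `log (1 + y) = 2 log r ≤ 2 (r - 1)` for `r = √(1 + y)`, which leaves `(r - 1) ^ 2`
  set r := √(1 + y)
  have hsq : y ^ 2 / 6 ≤ (r - 1) ^ 2 := by
    have h6 : (r + 1) ^ 2 ≤ 6 := by nlinarith
    calc y ^ 2 / 6 = (r - 1) ^ 2 * (r + 1) ^ 2 / 6 := by rw [hy']; ring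
      _ ≤ (r - 1) ^ 2 * 6 / 6 := by gcongr
      _ = (r - 1) ^ 2 := by ring
  nlinarith

lemma full_mul_div_sq (hp : p ∈ paramSpace d) (u : EuclideanSpace ℝ (Fin d)) (j : Fin (d + 1)) :
    full p j * (tangent u j / full p j) ^ 2 = tangent u j * tangent u j / full p j := by
  have := (full_pos hp j).ne'
  field_simp

lemma relEntropy_bounds {u : EuclideanSpace ℝ (Fin d)} (hp : p ∈ paramSpace d)
    (hu : ∀ j, |tangent u j| ≤ full p j / 2) :
    fisherInner p u u / 6 ≤ relEntropy p (p + u) ∧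
      relEntropy p (p + u) ≤ 2 * fisherInner p u u := by
  have hmem : p + u ∈ paramSpace d := mem_paramSpace_iff.2 fun j => by
    rw [full_add]
    linarith [(abs_le.1 (hu j)).1, full_pos hp j]
  have hy : ∀ j, |tangent u j / full p j| ≤ 1 / 2 := fun j => by
    rw [abs_div, abs_of_pos (full_pos hp j), div_le_iff₀ (full_pos hp j)]
    linarith [hu j]
  rw [relEntropy_eq hp hmem, add_sub_cancel_left, fisherInner, Finset.sum_div, Finset.mul_sum]
  constructor <;> refine Finset.sum_le_sum fun j _ => ?_ <;> rw [← full_mul_div_sq hp]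
  · linarith [mul_le_mul_of_nonneg_left (le_sub_log_one_add (hy j)) (full_pos hp j).le]
  · linarith [mul_le_mul_of_nonneg_left (sub_log_one_add_le (hy j)) (full_pos hp j).le]

lemma relEntropy_smul_le {u : EuclideanSpace ℝ (Fin d)} (hp : p ∈ paramSpace d)
    (hu : p + u ∈ paramSpace d) {t : ℝ} (ht : 0 ≤ t) (ht1 : t ≤ 1) :
    relEntropy p (p + t • u) ≤ t * relEntropy p (p + u) := by
  unfold relEntropy
  rw [Finset.mul_sum]
  refine Finset.sum_le_sum fun j _ => ?_
  have hcombo : full (p + t • u) j = (1 - t) • full p j + t • full (p + u) j := by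
    rw [full_add, full_add, tangent_smul]
    simp only [smul_eq_mul]
    ring
  have hconcave := strictConcaveOn_log_Ioi.concaveOn.2 (full_pos hp j) (full_pos hu j)
    (sub_nonneg.2 ht1) ht (by ring)
  rw [hcombo, mul_left_comm]
  refine mul_le_mul_of_nonneg_left ?_ (full_pos hp j).le
  simp only [smul_eq_mul] at hconcave ⊢
  linarith

/-- `tangent · j` as a continuous linear form. -/
noncomputable def tangentCLM (j : Fin (d + 1)) : EuclideanSpace ℝ (Fin d) →L[ℝ] ℝ :=
  LinearMap.toContinuousLinearMap
    { toFun := fun u => tangent u j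
      map_add' := fun u v => tangent_add u v j
      map_smul' := fun c u => tangent_smul c u j }

lemma tangentCLM_apply (j : Fin (d + 1)) (u : EuclideanSpace ℝ (Fin d)) :
    tangentCLM j u = tangent u j := rfl

lemma full_eq (θ : EuclideanSpace ℝ (Fin d)) (j : Fin (d + 1)) :
    full θ j = full 0 j + tangentCLM j θ := by
  rw [tangentCLM_apply, ← full_add, zero_add]

lemma hasFDerivAt_full (θ : EuclideanSpace ℝ (Fin d)) (j : Fin (d + 1)) :
    HasFDerivAt (fun θ : EuclideanSpace ℝ (Fin d) => full θ j) (tangentCLM j) θ := by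
  rw [funext fun θ => full_eq θ j]
  exact (tangentCLM j).hasFDerivAt.const_add _

lemma continuous_full (j : Fin (d + 1)) :
    Continuous fun θ : EuclideanSpace ℝ (Fin d) => full θ j :=
  continuous_iff_continuousAt.2 fun θ => (hasFDerivAt_full θ j).continuousAt

lemma isOpen_paramSpace : IsOpen (paramSpace d) := by
  have : paramSpace d = ⋂ j, {θ | 0 < full θ j} := by
    ext θ
    simp [mem_paramSpace_iff]
  rw [this]
  exact isOpen_iInter_of_finite fun j => isOpen_lt continuous_const (continuous_full j)

/-- The linear form `v ↦ ⟨u, F v⟩`, where `F` is the Fisher information matrix at `θ`. -/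
noncomputable def fisherDual (θ u : EuclideanSpace ℝ (Fin d)) : EuclideanSpace ℝ (Fin d) →L[ℝ] ℝ :=
  ∑ j, (tangent u j / full θ j) • tangentCLM j

lemma fisherDual_apply (θ u v : EuclideanSpace ℝ (Fin d)) :
    fisherDual θ u v = fisherInner θ u v := by
  simp [fisherDual, fisherInner, tangentCLM_apply, div_mul_eq_mul_div]

lemma hasFDerivAt_relEntropy (p : EuclideanSpace ℝ (Fin d)) (hθ : θ ∈ paramSpace d) :
    HasFDerivAt (relEntropy p) (fisherDual θ (θ - p)) θ := by
  have hterm : ∀ j, HasFDerivAt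
      (fun θ => full p j * (Real.log (full p j) - Real.log (full θ j)))
      (-((full p j / full θ j) • tangentCLM j)) θ := fun j => by
    refine ((((hasFDerivAt_full θ j).log (full_pos hθ j).ne').const_sub _).const_mul _).congr_fderiv
      ?_
    rw [smul_neg, smul_smul, div_eq_mul_inv]
  refine (HasFDerivAt.fun_sum fun j _ => hterm j).congr_fderiv ?_
  -- the difference is the form `v ↦ ∑ⱼ tangent v j`, which vanishes
  ext v
  rw [← sub_eq_zero, fisherDual, sum_apply, sum_apply,
    ← Finset.sum_sub_distrib, ← neg_eq_zero, ← sum_tangent v, ← Finset.sum_neg_distrib]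
  refine Finset.sum_congr rfl fun j _ => ?_
  have := (full_pos hθ j).ne'
  simp only [neg_apply, smul_apply, tangentCLM_apply, tangent_sub, smul_eq_mul]
  field_simp
  ring

lemma continuousOn_fisherDual_sub (p : EuclideanSpace ℝ (Fin d)) :
    ContinuousOn (fun θ => fisherDual θ (θ - p)) (paramSpace d) := by
  refine continuousOn_finsetSum _ fun j _ =>
    ContinuousOn.fun_smul (ContinuousOn.div₀ ?_ ?_ ?_) continuousOn_const
  · exact ((tangentCLM j).continuous.comp (continuous_id.sub continuous_const)).continuousOn
  · exact (continuous_full j).continuousOn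
  · exact fun θ hθ => (full_pos hθ j).ne'

/-- The vector of relative frequencies of the states `1, …, d`. -/
noncomputable def freq (n : ℕ) (N : Fin (d + 1) → ℕ) : EuclideanSpace ℝ (Fin d) :=
  WithLp.toLp 2 fun j => (N j.succ : ℝ) / n

variable {n : ℕ} {N : Fin (d + 1) → ℕ}

lemma full_freq (hn : 0 < n) (hN : ∑ j, N j = n) (j : Fin (d + 1)) :
    full (freq n N) j = (N j : ℝ) / n := by
  have hn' : (n : ℝ) ≠ 0 := by positivity
  refine Fin.cases ?_ (fun i => ?_) j
  · simp only [full, freq, Fin.cons_zero]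
    rw [← Finset.sum_div, eq_div_iff hn', sub_mul, div_mul_cancel₀ _ hn', one_mul,
      sub_eq_iff_eq_add, ← hN, Fin.sum_univ_succ]
    push_cast
    rfl
  · simp [full, freq]

lemma negLogLik_eq_add_relEntropy (hn : 0 < n) (hN : ∑ j, N j = n)
    (θ : EuclideanSpace ℝ (Fin d)) :
    negLogLik n N θ = negLogLik n N (freq n N) + relEntropy (freq n N) θ := by
  simp only [negLogLik, relEntropy, full_freq hn hN, mul_sub, Finset.sum_sub_distrib]
  ring

lemma isMLE_freq (hn : 0 < n) (hN : ∑ j, N j = n) (hp : freq n N ∈ paramSpace d) :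
    IsMLE n N (freq n N) := by
  refine ⟨hp, isMinOn_iff.2 fun θ hθ => ?_⟩
  rw [negLogLik_eq_add_relEntropy hn hN θ]
  exact le_add_of_nonneg_right (relEntropy_nonneg hp hθ)

lemma eq_freq_of_isMLE (hn : 0 < n) (hN : ∑ j, N j = n) (hp : freq n N ∈ paramSpace d)
    (hθ : IsMLE n N θ) : θ = freq n N := by
  refine eq_of_relEntropy_eq_zero hp hθ.1 (le_antisymm ?_ (relEntropy_nonneg hp hθ.1))
  have hmin := isMinOn_iff.1 hθ.2 _ hp
  rwa [negLogLik_eq_add_relEntropy hn hN θ, add_le_iff_nonpos_right] at hmin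

end Likelihood

section NormChernoff
open Metric
open scoped RealInnerProductSpace ENNReal
variable {E : Type*} [NormedAddCommGroup E] [InnerProductSpace ℝ E] [FiniteDimensional ℝ E]
  [MeasurableSpace E] [BorelSpace E]

-- on the ball of radius `R / 4` about `(3 R / 4) z / ‖z‖` the exponent is at least `R ‖z‖ / 2`
lemma exp_mul_volume_le_setLIntegral_exp_inner {R : ℝ} (hR : 0 ≤ R) (z : E) :
    ENNReal.ofReal (Real.exp (R * ‖z‖ / 2)) * volume (closedBall (0 : E) (1 / 4 * R)) ≤
      ∫⁻ u in closedBall (0 : E) R, ENNReal.ofReal (Real.exp ⟪z, u⟫) := by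
  set e := (3 * R / 4 / ‖z‖) • z
  have hze : ⟪z, e⟫ = 3 * R / 4 * ‖z‖ := by
    rw [real_inner_smul_right, real_inner_self_eq_norm_mul_norm, ← mul_assoc]
    rcases eq_or_ne ‖z‖ 0 with hz | hz
    · rw [hz, mul_zero, mul_zero]
    · rw [div_mul_cancel₀ _ hz]
  have hnorm : ‖e‖ ≤ 3 / 4 * R := by
    rw [norm_smul, Real.norm_of_nonneg (by positivity)]
    rcases eq_or_ne ‖z‖ 0 with hz | hz
    · rw [hz, mul_zero]
      positivity
    · rw [div_mul_cancel₀ _ hz, mul_div_right_comm]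
  rw [← Measure.addHaar_closedBall_center volume e, ← setLIntegral_const]
  refine (setLIntegral_mono' isClosed_closedBall.measurableSet fun u hu => ?_).trans
    (lintegral_mono_set (closedBall_subset_closedBall' ?_))
  · have hue : ‖u - e‖ ≤ 1 / 4 * R := by simpa [dist_eq_norm] using hu
    have hinner := (abs_le.1 ((abs_real_inner_le_norm z (u - e)).trans
      (mul_le_mul_of_nonneg_left hue (norm_nonneg z)))).1
    rw [inner_sub_right, hze] at hinner
    gcongr
    linarith
  · rw [dist_zero_right]
    linarith

/-- A Chernoff bound in which the exponential moments are averaged over a ball of directions. -/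
lemma measure_norm_ge_le {Ω : Type*} [MeasurableSpace Ω] {P : Measure Ω} [SFinite P] {z : Ω → E}
    (hz : Measurable z) {R : ℝ} (hR : 0 < R) {M : ℝ≥0∞}
    (hmgf : ∀ u : E, ‖u‖ ≤ R → ∫⁻ ω, ENNReal.ofReal (Real.exp ⟪z ω, u⟫) ∂P ≤ M) (T : ℝ) :
    P {ω | T ≤ ‖z ω‖} ≤
      ENNReal.ofReal (4 ^ Module.finrank ℝ E * Real.exp (-(R * T / 2))) * M := by
  set V := volume (closedBall (0 : E) R)
  have hV0 : V ≠ 0 := (measure_closedBall_pos _ _ hR).ne'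
  have hVt : V ≠ ∞ := measure_closedBall_lt_top.ne
  set c := Real.exp (R * T / 2) * (1 / 4) ^ Module.finrank ℝ E with hc
  have hpos : 0 < c := by positivity
  have hlow : ∀ ω ∈ {ω | T ≤ ‖z ω‖}, ENNReal.ofReal c * V ≤
      ∫⁻ u in closedBall (0 : E) R, ENNReal.ofReal (Real.exp ⟪z ω, u⟫) := fun ω hω => by
    refine le_trans ?_ (exp_mul_volume_le_setLIntegral_exp_inner hR.le (z ω))
    rw [Measure.addHaar_closedBall_mul _ _ (by norm_num) hR.le, ← mul_assoc,
      hc, ENNReal.ofReal_mul (Real.exp_pos _).le]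
    gcongr
    exact hω
  have hmeas : Measurable (Function.uncurry fun (ω : Ω) (u : E) =>
      ENNReal.ofReal (Real.exp ⟪z ω, u⟫)) :=
    (Real.measurable_exp.comp ((hz.comp measurable_fst).inner measurable_snd)).ennreal_ofReal
  have hmarkov : ENNReal.ofReal c * V * P {ω | T ≤ ‖z ω‖} ≤ M * V := by
    calc _ = ∫⁻ _ in {ω | T ≤ ‖z ω‖}, ENNReal.ofReal c * V ∂P := (setLIntegral_const _ _).symm
      _ ≤ ∫⁻ ω in {ω | T ≤ ‖z ω‖}, (∫⁻ u in closedBall (0 : E) R,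
          ENNReal.ofReal (Real.exp ⟪z ω, u⟫)) ∂P :=
          setLIntegral_mono' (measurableSet_le measurable_const hz.norm) hlow
      _ ≤ ∫⁻ ω, (∫⁻ u in closedBall (0 : E) R, ENNReal.ofReal (Real.exp ⟪z ω, u⟫)) ∂P :=
          setLIntegral_le_lintegral _ _
      _ = ∫⁻ u in closedBall (0 : E) R, (∫⁻ ω, ENNReal.ofReal (Real.exp ⟪z ω, u⟫) ∂P) :=
          lintegral_lintegral_swap hmeas.aemeasurable
      _ ≤ ∫⁻ _ in closedBall (0 : E) R, M :=
          setLIntegral_mono' isClosed_closedBall.measurableSet fun u hu =>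
            hmgf u (mem_closedBall_zero_iff.1 hu)
      _ = M * V := setLIntegral_const _ _
  have hinv : 4 ^ Module.finrank ℝ E * Real.exp (-(R * T / 2)) = c⁻¹ := by
    rw [hc, Real.exp_neg, mul_inv, one_div, inv_pow, inv_inv, mul_comm]
  rw [mul_right_comm, ENNReal.mul_le_mul_iff_left hV0 hVt] at hmarkov
  rw [hinv, ENNReal.ofReal_inv_of_pos hpos, mul_comm, ← div_eq_mul_inv]
  exact ENNReal.le_div_iff_mul_le (Or.inl (ENNReal.ofReal_pos.2 hpos).ne')
    (Or.inl ENNReal.ofReal_ne_top) |>.2 (by rwa [mul_comm])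

end NormChernoff

section Concentration
open scoped RealInnerProductSpace ENNReal
variable {d : ℕ} {θ : EuclideanSpace ℝ (Fin d)}

lemma exp_le_one_add_add_sq {x : ℝ} (hx : |x| ≤ 1) : Real.exp x ≤ 1 + x + x ^ 2 := by
  linarith [(abs_le.1 (Real.abs_exp_sub_one_sub_id_le hx)).2]

lemma isProbabilityMeasure_categorical (hθ : θ ∈ paramSpace d) :
    IsProbabilityMeasure (categorical θ) := by
  constructor
  simp only [categorical, Measure.coe_finsetSum, Finset.sum_apply, Measure.smul_apply,
    measure_univ, smul_eq_mul, mul_one]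
  rw [← ENNReal.ofReal_sum_of_nonneg fun j _ => (full_pos hθ j).le, sum_full, ENNReal.ofReal_one]

lemma isProbabilityMeasure_multinomial (n : ℕ) (hθ : θ ∈ paramSpace d) :
    IsProbabilityMeasure (multinomial n θ) := by
  have := isProbabilityMeasure_categorical hθ
  exact Measure.isProbabilityMeasure_map (measurable_of_finite _).aemeasurable

lemma lintegral_categorical (θ : EuclideanSpace ℝ (Fin d)) (f : Fin (d + 1) → ℝ≥0∞) :
    ∫⁻ j, f j ∂categorical θ = ∑ j, ENNReal.ofReal (full θ j) * f j := by
  simp [categorical]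

lemma lintegral_exp_categorical_le (hθ : θ ∈ paramSpace d) {w : Fin (d + 1) → ℝ}
    (hmean : ∑ j, full θ j * w j = 0) (hw : ∀ j, |w j| ≤ 1) :
    ∫⁻ j, ENNReal.ofReal (Real.exp (w j)) ∂categorical θ ≤
      ENNReal.ofReal (Real.exp (∑ j, full θ j * w j ^ 2)) := by
  rw [lintegral_categorical]
  simp_rw [← ENNReal.ofReal_mul (full_pos hθ _).le]
  rw [← ENNReal.ofReal_sum_of_nonneg fun j _ => mul_nonneg (full_pos hθ j).le (Real.exp_pos _).le]
  refine ENNReal.ofReal_le_ofReal ?_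
  calc _ ≤ ∑ j, full θ j * (1 + w j + w j ^ 2) := Finset.sum_le_sum fun j _ =>
        mul_le_mul_of_nonneg_left (exp_le_one_add_add_sq (hw j)) (full_pos hθ j).le
    _ = ∑ j, full θ j * w j ^ 2 + 1 := by
        simp only [mul_add, mul_one, Finset.sum_add_distrib, sum_full, hmean, add_zero]
        exact add_comm _ _
    _ ≤ _ := Real.add_one_le_exp _

lemma lintegral_exp_sum_pi_categorical (hθ : θ ∈ paramSpace d) (n : ℕ) (w : Fin (d + 1) → ℝ) :
    ∫⁻ x, ENNReal.ofReal (Real.exp (∑ i, w (x i))) ∂(Measure.pi fun _ : Fin n => categorical θ) =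
      (∫⁻ j, ENNReal.ofReal (Real.exp (w j)) ∂categorical θ) ^ n := by
  have := isProbabilityMeasure_categorical hθ
  rw [← ofReal_integral_eq_lintegral_ofReal (.of_finite) (ae_of_all _ fun _ => (Real.exp_pos _).le),
    ← ofReal_integral_eq_lintegral_ofReal (.of_finite) (ae_of_all _ fun _ => (Real.exp_pos _).le),
    ← ENNReal.ofReal_pow (integral_nonneg fun _ => (Real.exp_pos _).le)]
  simp_rw [Real.exp_sum]
  rw [integral_fintype_prod_eq_prod (f := fun (_ : Fin n) j => Real.exp (w j))]
  simp

lemma sum_counts {n : ℕ} (x : Fin n → Fin (d + 1)) : ∑ j, counts x j = n := by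
  simpa [counts] using (Finset.card_eq_sum_card_fiberwise (f := x) (s := Finset.univ)
    (t := Finset.univ) (by simp)).symm

lemma sum_counts_mul {n : ℕ} (x : Fin n → Fin (d + 1)) (w : Fin (d + 1) → ℝ) :
    ∑ j, (counts x j : ℝ) * w j = ∑ i, w (x i) := by
  rw [← Finset.sum_fiberwise (s := Finset.univ) (g := x) (f := fun i => w (x i))]
  refine Finset.sum_congr rfl fun j _ => ?_
  rw [Finset.sum_congr rfl (g := fun _ => w j) fun i hi => by rw [(Finset.mem_filter.1 hi).2]]
  simp [counts]

lemma sum_full_mul_tangent_div (hθ : θ ∈ paramSpace d) (u : EuclideanSpace ℝ (Fin d)) :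
    ∑ j, full θ j * (tangent u j / full θ j) = 0 := by
  simp_rw [mul_div_cancel₀ _ (full_pos hθ _).ne', sum_tangent]

lemma mul_fisherInner_freq_sub (hθ : θ ∈ paramSpace d) {n : ℕ} (hn : 0 < n)
    (x : Fin n → Fin (d + 1)) (u : EuclideanSpace ℝ (Fin d)) :
    n * fisherInner θ (freq n (counts x) - θ) u = ∑ i, tangent u (x i) / full θ (x i) := by
  have hterm : ∀ j, (n : ℝ) * (tangent (freq n (counts x) - θ) j * tangent u j / full θ j) =
      counts x j * (tangent u j / full θ j) - n * (full θ j * (tangent u j / full θ j)) := by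
    intro j
    rw [tangent_sub, full_freq hn (sum_counts x)]
    field_simp
  rw [← sum_counts_mul x fun j => tangent u j / full θ j, fisherInner, Finset.mul_sum]
  simp_rw [hterm]
  rw [Finset.sum_sub_distrib, ← Finset.mul_sum, sum_full_mul_tangent_div hθ, mul_zero, sub_zero]

lemma lintegral_exp_fisherInner_freq_sub_le (hθ : θ ∈ paramSpace d) {n : ℕ} (hn : 0 < n)
    {u : EuclideanSpace ℝ (Fin d)} (hu : ∀ j, |tangent u j| ≤ full θ j) :
    ∫⁻ x, ENNReal.ofReal (Real.exp (n * fisherInner θ (freq n (counts x) - θ) u))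
        ∂(Measure.pi fun _ : Fin n => categorical θ) ≤
      ENNReal.ofReal (Real.exp (n * fisherInner θ u u)) := by
  have hw : ∀ j, |tangent u j / full θ j| ≤ 1 := fun j => by
    rw [abs_div, abs_of_pos (full_pos hθ j)]
    exact (div_le_one (full_pos hθ j)).2 (hu j)
  have hvar : ∑ j, full θ j * (tangent u j / full θ j) ^ 2 = fisherInner θ u u :=
    Finset.sum_congr rfl fun j _ => full_mul_div_sq hθ u j
  simp_rw [mul_fisherInner_freq_sub hθ hn]
  rw [lintegral_exp_sum_pi_categorical hθ n fun j => tangent u j / full θ j, Real.exp_nat_mul,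
    ENNReal.ofReal_pow (Real.exp_pos _).le, ← hvar]
  gcongr
  exact lintegral_exp_categorical_le hθ (sum_full_mul_tangent_div hθ u) hw

lemma IsFisherFrame.measure_norm_ge_le {n : ℕ}
    {L : EuclideanSpace ℝ (Fin d) ≃L[ℝ] EuclideanSpace ℝ (Fin d)} (h : IsFisherFrame n θ L)
    (hθ : θ ∈ paramSpace d) (hn : 0 < n) {R : ℝ} (hR : 0 < R) (hRn : R ≤ √(n * minProb θ)) (T : ℝ) :
    (Measure.pi fun _ : Fin n => categorical θ) {x | T ≤ ‖L.symm (freq n (counts x) - θ)‖} ≤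
      ENNReal.ofReal (4 ^ d * Real.exp (R ^ 2 - R * T / 2)) := by
  have := isProbabilityMeasure_categorical hθ
  have hn' : (0 : ℝ) < n := by exact_mod_cast hn
  have hmgf : ∀ u : EuclideanSpace ℝ (Fin d), ‖u‖ ≤ R →
      ∫⁻ x, ENNReal.ofReal (Real.exp ⟪L.symm (freq n (counts x) - θ), u⟫)
        ∂(Measure.pi fun _ : Fin n => categorical θ) ≤ ENNReal.ofReal (Real.exp (R ^ 2)) := by
    intro u hu
    simp_rw [← h.mul_fisherInner, L.apply_symm_apply]
    refine (lintegral_exp_fisherInner_freq_sub_le hθ hn fun j => ?_).trans ?_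
    · exact (h.abs_tangent_le hn' hθ u j).trans (mul_le_of_le_one_right (full_pos hθ j).le
        (div_le_one_of_le₀ (hu.trans hRn) (Real.sqrt_nonneg _)))
    · rw [h.mul_fisherInner, real_inner_self_eq_norm_sq]
      gcongr
  refine (MultinomialBvM.measure_norm_ge_le (measurable_of_finite _) hR hmgf T).trans_eq ?_
  rw [← ENNReal.ofReal_mul (by positivity), finrank_euclideanSpace_fin, mul_assoc, ← Real.exp_add]
  ring_nf

lemma four_pow_mul_exp_le (d : ℕ) {s : ℝ} (hs : 16 ≤ s) :
    4 ^ d * Real.exp (-(s ^ 2 * d / 64)) ≤ Real.exp (-(1 / 128 * d * s ^ 2)) := by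
  have hfour : (4 : ℝ) ≤ Real.exp 2 := by
    calc (4 : ℝ) = (1 + 1) ^ 2 := by norm_num
      _ ≤ Real.exp 1 ^ 2 := by
          gcongr
          exact Real.add_one_le_exp 1
      _ = Real.exp 2 := by rw [← Real.exp_nat_mul]; norm_num
  calc _ ≤ Real.exp 2 ^ d * Real.exp (-(s ^ 2 * d / 64)) := by gcongr
    _ = Real.exp (d * 2 + -(s ^ 2 * d / 64)) := by rw [← Real.exp_nat_mul, Real.exp_add]
    _ ≤ _ := by
        have hs2 : 256 ≤ s ^ 2 := by nlinarith
        gcongr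
        nlinarith [mul_le_mul_of_nonneg_right hs2 d.cast_nonneg]

lemma multinomial_concentration {n : ℕ} (hn : 0 < n) (hd : 0 < d) (hθ : θ ∈ paramSpace d) {s : ℝ}
    (hs : 16 ≤ s) (hsmall : 8 * (s * √d) ≤ √(n * minProb θ)) :
    1 - Real.exp (-(1 / 128 * d * s ^ 2)) ≤ (multinomial n θ).real
      {N | ∑ j, N j = n ∧ wnorm (fisher θ) (freq n N - θ) ≤ s / 2 * √((d : ℝ) / n)} := by
  have := isProbabilityMeasure_categorical hθ
  have hn' : (0 : ℝ) < n := by exact_mod_cast hn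
  obtain ⟨L, hL⟩ := exists_isFisherFrame hθ hn'
  set P := Measure.pi fun _ : Fin n => categorical θ
  set T := s * √d / 2 with hT
  have hbad : P.real {x | T ≤ ‖L.symm (freq n (counts x) - θ)‖} ≤
      Real.exp (-(1 / 128 * d * s ^ 2)) := by
    refine ENNReal.toReal_le_of_le_ofReal (Real.exp_pos _).le ((hL.measure_norm_ge_le hθ hn
      (R := T / 4) (by positivity) (le_trans ?_ hsmall) T).trans ?_)
    · linarith [show 0 < s * √d by positivity]
    · have hexp : (T / 4) ^ 2 - T / 4 * T / 2 = -(s ^ 2 * d / 64) := by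
        rw [hT]
        linear_combination -(s ^ 2 / 64) * Real.sq_sqrt (Nat.cast_nonneg (α := ℝ) d)
      rw [hexp]
      exact ENNReal.ofReal_le_ofReal (four_pow_mul_exp_le d hs)
  have hgood : {x : Fin n → Fin (d + 1) | T ≤ ‖L.symm (freq n (counts x) - θ)‖}ᶜ ⊆ counts ⁻¹'
      {N | ∑ j, N j = n ∧ wnorm (fisher θ) (freq n N - θ) ≤ s / 2 * √((d : ℝ) / n)} := by
    intro x hx
    refine ⟨sum_counts x, ?_⟩
    rw [← L.apply_symm_apply (freq n (counts x) - θ), hL.wnorm_eq hn',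
      Real.sqrt_div d.cast_nonneg, mul_div_assoc', mul_comm_div s, mul_div_assoc']
    gcongr
    exact (not_le.1 (Set.notMem_ofPred_iff.1 hx)).le
  rw [multinomial,
    map_measureReal_apply (measurable_of_finite _) (Set.to_countable _).measurableSet]
  calc _ ≤ 1 - P.real {x | T ≤ ‖L.symm (freq n (counts x) - θ)‖} := sub_le_sub_left hbad 1
    _ = P.real {x | T ≤ ‖L.symm (freq n (counts x) - θ)‖}ᶜ :=
        (probReal_compl_eq_one_sub (Set.toFinite _).measurableSet).symm
    _ ≤ _ := measureReal_mono hgood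

end Concentration

section LocalFrame
open scoped RealInnerProductSpace
variable {d : ℕ}

/-- The situation on the event that the empirical frequencies `p` are close to the true parameter
`θs`: coordinates in which `n` times the Fisher information at `θs` is the identity matrix, together
with a radius `R` (to be `s √d`) such that `p` has distance at most `R / 2` from `θs` and the
probabilities vary by a small relative amount on balls of radius comparable to `R`. -/
structure IsLocalFrame (n : ℕ) (R : ℝ) (θs p : EuclideanSpace ℝ (Fin d))
    (L : EuclideanSpace ℝ (Fin d) ≃L[ℝ] EuclideanSpace ℝ (Fin d)) : Prop
    extends IsFisherFrame n θs L where
  mem : θs ∈ paramSpace d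
  n_pos : 0 < n
  radius_pos : 0 < R
  small : 8 * R ≤ √(n * minProb θs)
  close : ‖L.symm (p - θs)‖ ≤ R / 2

namespace IsLocalFrame
variable {n : ℕ} {R : ℝ} {θs p : EuclideanSpace ℝ (Fin d)}
  {L : EuclideanSpace ℝ (Fin d) ≃L[ℝ] EuclideanSpace ℝ (Fin d)}

lemma n_pos_real (h : IsLocalFrame n R θs p L) : (0 : ℝ) < n := by exact_mod_cast h.n_pos

lemma ratio_nonneg (h : IsLocalFrame n R θs p L) : 0 ≤ R / √(n * minProb θs) :=
  div_nonneg h.radius_pos.le (Real.sqrt_nonneg _)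

lemma ratio_le (h : IsLocalFrame n R θs p L) : R / √(n * minProb θs) ≤ 1 / 8 := by
  refine div_le_of_le_mul₀ (Real.sqrt_nonneg _) (by norm_num) ?_
  linarith [h.small]

section Neighbourhood
variable {θ : EuclideanSpace ℝ (Fin d)} {t : ℝ}

lemma abs_full_sub_le (h : IsLocalFrame n R θs p L) (hθ : ‖L.symm (θ - θs)‖ ≤ t * R)
    (j : Fin (d + 1)) :
    |full θ j - full θs j| ≤ t * (R / √(n * minProb θs)) * full θs j := by
  have hle := h.abs_tangent_le h.n_pos_real h.mem (L.symm (θ - θs)) j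
  rw [L.apply_symm_apply, tangent_sub] at hle
  refine hle.trans ?_
  rw [mul_comm, mul_div_assoc']
  have := (full_pos h.mem j).le
  gcongr

lemma three_quarters_mul_full_le (h : IsLocalFrame n R θs p L)
    (hθ : ‖L.symm (θ - θs)‖ ≤ 2 * R) (j : Fin (d + 1)) : 3 / 4 * full θs j ≤ full θ j := by
  have hratio := mul_le_mul_of_nonneg_right h.ratio_le (full_pos h.mem j).le
  linarith [(abs_le.1 (h.abs_full_sub_le hθ j)).1]

lemma mem_paramSpace (h : IsLocalFrame n R θs p L) (hθ : ‖L.symm (θ - θs)‖ ≤ 2 * R) :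
    θ ∈ paramSpace d :=
  mem_paramSpace_iff.2 fun j =>
    (mul_pos (by norm_num) (full_pos h.mem j)).trans_le (h.three_quarters_mul_full_le hθ j)

lemma abs_mul_fisherInner_sub_le (h : IsLocalFrame n R θs p L)
    (hθ : ‖L.symm (θ - θs)‖ ≤ t * R) (ht : t ≤ 2) (x y : EuclideanSpace ℝ (Fin d)) :
    |n * fisherInner θ (L x) (L y) - ⟪x, y⟫| ≤
      2 * t * (R / √(n * minProb θs)) * (‖x‖ * ‖y‖) := by
  have ht0 : 0 ≤ t := nonneg_of_mul_nonneg_left ((norm_nonneg _).trans hθ) h.radius_pos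
  have hθ2 : ‖L.symm (θ - θs)‖ ≤ 2 * R :=
    hθ.trans (mul_le_mul_of_nonneg_right ht h.radius_pos.le)
  refine h.abs_fisherInner_sub_le h.n_pos_real h.mem (h.mem_paramSpace hθ2) (fun j => ?_) x y
  refine (h.abs_full_sub_le hθ j).trans ?_
  have hcoef : 0 ≤ t * (R / √(n * minProb θs)) := mul_nonneg ht0 h.ratio_nonneg
  have hfull : full θs j ≤ 2 * full θ j := by
    linarith [h.three_quarters_mul_full_le hθ2 j, full_pos h.mem j]
  calc _ ≤ t * (R / √(n * minProb θs)) * (2 * full θ j) := mul_le_mul_of_nonneg_left hfull hcoef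
    _ = _ := by ring

end Neighbourhood

lemma center_mem (h : IsLocalFrame n R θs p L) : p ∈ paramSpace d :=
  h.mem_paramSpace (h.close.trans (by linarith [h.radius_pos]))

section Ball
variable {x : EuclideanSpace ℝ (Fin d)}

lemma norm_symm_add_sub_le (h : IsLocalFrame n R θs p L) (hx : ‖x‖ ≤ √2 * R) :
    ‖L.symm (p + L x - θs)‖ ≤ 2 * R := by
  have hsqrt : √2 ≤ 3 / 2 := (Real.sqrt_le_left (by norm_num)).2 (by norm_num)
  have heq : L.symm (p + L x - θs) = L.symm (p - θs) + x := by
    rw [add_sub_right_comm, map_add, L.symm_apply_apply]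
  calc _ ≤ ‖L.symm (p - θs)‖ + ‖x‖ := heq ▸ norm_add_le _ _
    _ ≤ R / 2 + √2 * R := add_le_add h.close hx
    _ ≤ 2 * R := by linarith [mul_le_mul_of_nonneg_right hsqrt h.radius_pos.le]

lemma wnorm_add_sub_le (h : IsLocalFrame n R θs p L) (hx : ‖x‖ ≤ √2 * R) :
    wnorm (fisher θs) (p + L x - θs) ≤ 2 * R / √n := by
  rw [← L.apply_symm_apply (p + L x - θs), h.wnorm_eq h.n_pos_real]
  gcongr
  exact h.norm_symm_add_sub_le hx

lemma add_mem (h : IsLocalFrame n R θs p L) (hx : ‖x‖ ≤ √2 * R) : p + L x ∈ paramSpace d :=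
  h.mem_paramSpace (h.norm_symm_add_sub_le hx)

lemma abs_mul_fisherInner_add_sub_le (h : IsLocalFrame n R θs p L) (hx : ‖x‖ ≤ √2 * R)
    (v : EuclideanSpace ℝ (Fin d)) :
    |n * fisherInner (p + L x) (L x) (L v) - ⟪x, v⟫| ≤
      4 * (R / √(n * minProb θs)) * (‖x‖ * ‖v‖) :=
  (h.abs_mul_fisherInner_sub_le (h.norm_symm_add_sub_le hx) le_rfl x v).trans_eq (by ring)

lemma relEntropy_bounds (h : IsLocalFrame n R θs p L) (hx : ‖x‖ ≤ √2 * R) :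
    ‖x‖ ^ 2 / 12 ≤ n * relEntropy p (p + L x) ∧ n * relEntropy p (p + L x) ≤ 4 * ‖x‖ ^ 2 := by
  have hsmall : ∀ j, |tangent (L x) j| ≤ full p j / 2 := fun j => by
    have hθ := h.abs_full_sub_le (h.norm_symm_add_sub_le hx) j
    have hp := h.abs_full_sub_le (t := 1 / 2) (h.close.trans_eq (by ring)) j
    have hratio := mul_le_mul_of_nonneg_right h.ratio_le (full_pos h.mem j).le
    rw [← add_sub_cancel_left p (L x), tangent_sub, abs_le]
    rw [abs_le] at hθ hp
    constructor <;> linarith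
  have hfisher : |n * fisherInner p (L x) (L x) - ‖x‖ ^ 2| ≤ ‖x‖ ^ 2 / 8 := by
    have hle := h.abs_mul_fisherInner_sub_le (t := 1 / 2) (h.close.trans_eq (by ring))
      (by norm_num) x x
    rw [real_inner_self_eq_norm_sq, ← sq] at hle
    linarith [mul_le_mul_of_nonneg_right h.ratio_le (sq_nonneg ‖x‖)]
  obtain ⟨hlo, hhi⟩ := MultinomialBvM.relEntropy_bounds h.center_mem hsmall
  have hlo' := mul_le_mul_of_nonneg_left hlo h.n_pos_real.le
  have hhi' := mul_le_mul_of_nonneg_left hhi h.n_pos_real.le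
  rw [abs_le] at hfisher
  constructor <;> linarith [sq_nonneg ‖x‖]

lemma linear_growth (h : IsLocalFrame n R θs p L) (hx : R ≤ ‖x‖) (hmem : p + L x ∈ paramSpace d) :
    R * ‖x‖ / 12 ≤ n * relEntropy p (p + L x) := by
  have hx0 : 0 < ‖x‖ := h.radius_pos.trans_le hx
  have ht0 : 0 ≤ R / ‖x‖ := div_nonneg h.radius_pos.le hx0.le
  have hnorm : ‖(R / ‖x‖) • x‖ = R := by
    rw [norm_smul, Real.norm_of_nonneg ht0, div_mul_cancel₀ _ hx0.ne']
  have hconvex := mul_le_mul_of_nonneg_left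
    (relEntropy_smul_le h.center_mem hmem ht0 ((div_le_one hx0).2 hx)) h.n_pos_real.le
  have hsphere := (h.relEntropy_bounds (x := (R / ‖x‖) • x)
    (hnorm.trans_le (le_mul_of_one_le_left h.radius_pos.le (Real.one_le_sqrt.2 one_le_two)))).1
  rw [map_smul, hnorm] at hsphere
  have hle : R / ‖x‖ * (R * ‖x‖ / 12) ≤ R / ‖x‖ * (n * relEntropy p (p + L x)) := by
    calc _ = R ^ 2 / 12 := by field_simp
      _ ≤ _ := hsphere.trans (hconvex.trans_eq (mul_left_comm _ _ _))
  exact le_of_mul_le_mul_left hle (div_pos h.radius_pos hx0)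

end Ball
end IsLocalFrame
end LocalFrame

section Prior
open scoped RealInnerProductSpace
variable {d n : ℕ} {s D : ℝ} {θs p : EuclideanSpace ℝ (Fin d)}
  {L : EuclideanSpace ℝ (Fin d) ≃L[ℝ] EuclideanSpace ℝ (Fin d)}
  {prior : EuclideanSpace ℝ (Fin d) → ℝ}

/-- The finiteness of `δ*₀₁(r)` in terms of real numbers: on `U*(r)` the prior is positive and
continuously differentiable, and the gradient of its logarithm has dual norm at most `D`. -/
structure IsRegularPrior (n : ℕ) (θs : EuclideanSpace ℝ (Fin d))
    (prior : EuclideanSpace ℝ (Fin d) → ℝ) (r D : ℝ) : Prop where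
  bound_nonneg : 0 ≤ D
  pos : ∀ θ ∈ nbhd n θs r, 0 < prior θ
  diff : ∀ θ ∈ nbhd n θs r, DifferentiableAt ℝ prior θ
  cont : ContinuousOn (gradient prior) (nbhd n θs r)
  bound : ∀ θ ∈ nbhd n θs r, ∀ u, wnorm (fisher θs) u = 1 →
    ⟪gradient (fun η => Real.log (prior η)) θ, u⟫ ≤ D

lemma isRegularPrior_of_delta01_ne_top {r : ℝ} (h : delta01 n θs prior r ≠ ⊤) :
    IsRegularPrior n θs prior r (delta01 n θs prior r).toReal := by
  by_cases hC1 : (∀ θ ∈ nbhd n θs r, 0 < prior θ ∧ DifferentiableAt ℝ prior θ) ∧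
      ContinuousOn (gradient prior) (nbhd n θs r)
  · refine ⟨ENNReal.toReal_nonneg, fun θ hθ => (hC1.1 θ hθ).1, fun θ hθ => (hC1.1 θ hθ).2,
      hC1.2, fun θ hθ u hu => (ENNReal.ofReal_le_iff_le_toReal h).1 ?_⟩
    rw [delta01, if_pos hC1]
    exact (le_iSup₂_of_le u hu le_rfl).trans (le_iSup₂ (f := fun θ (_ : θ ∈ nbhd n θs r) =>
      wopNorm (fisher θs) (gradient (fun η => Real.log (prior η)) θ)) θ hθ)
  · rw [delta01, if_neg hC1] at h
    exact absurd rfl h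

namespace IsRegularPrior
variable {r : ℝ} {θ : EuclideanSpace ℝ (Fin d)}

lemma hasGradientAt_log (hp : IsRegularPrior n θs prior r D) (hθ : θ ∈ nbhd n θs r) :
    HasGradientAt (fun η => Real.log (prior η)) (gradient (fun η => Real.log (prior η)) θ) θ :=
  ((hp.diff θ hθ).log (hp.pos θ hθ).ne').hasGradientAt

lemma gradient_log_eq (hp : IsRegularPrior n θs prior r D) (hθ : θ ∈ nbhd n θs r) :
    gradient (fun η => Real.log (prior η)) θ = (prior θ)⁻¹ • gradient prior θ := by
  refine HasGradientAt.gradient (hasGradientAt_iff_hasFDerivAt.2 ?_)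
  exact ((hp.diff θ hθ).hasGradientAt.hasFDerivAt.log (hp.pos θ hθ).ne').congr_fderiv
    (by rw [map_smulₛₗ, conj_trivial])

lemma continuousOn_gradient_log (hp : IsRegularPrior n θs prior r D) :
    ContinuousOn (gradient fun η => Real.log (prior η)) (nbhd n θs r) := by
  have hprior : ContinuousOn prior (nbhd n θs r) := fun θ hθ =>
    (hp.diff θ hθ).continuousAt.continuousWithinAt
  exact ((hprior.inv₀ fun θ hθ => (hp.pos θ hθ).ne').smul hp.cont).congr
    fun θ hθ => hp.gradient_log_eq hθ

lemma abs_inner_gradient_le (hp : IsRegularPrior n θs prior r D) (hL : IsFisherFrame n θs L)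
    (hn : 0 < n) (hθ : θ ∈ nbhd n θs r) (v : EuclideanSpace ℝ (Fin d)) :
    |⟪gradient (fun η => Real.log (prior η)) θ, L v⟫| ≤ D / √n * ‖v‖ := by
  have hn' : (0 : ℝ) < n := by exact_mod_cast hn
  have hsqrt : 0 < √(n : ℝ) := Real.sqrt_pos.2 hn'
  have upper (x : EuclideanSpace ℝ (Fin d)) :
      ⟪gradient (fun η => Real.log (prior η)) θ, L x⟫ ≤ D / √n * ‖x‖ := by
    rcases eq_or_ne x 0 with rfl | hx
    · simp
    have hx0 : 0 < ‖x‖ := norm_pos_iff.2 hx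
    have hunit : wnorm (fisher θs) (L ((√n / ‖x‖) • x)) = 1 := by
      rw [hL.wnorm_eq hn', norm_smul, Real.norm_of_nonneg (by positivity)]
      field_simp
    have hle := hp.bound θ hθ _ hunit
    rw [map_smul, real_inner_smul_right, div_mul_eq_mul_div, div_le_iff₀ hx0] at hle
    rwa [div_mul_eq_mul_div, le_div_iff₀ hsqrt, mul_comm]
  refine abs_le.2 ⟨?_, upper v⟩
  have hneg := upper (-v)
  rw [map_neg, inner_neg_right, norm_neg] at hneg
  exact neg_le.1 hneg

end IsRegularPrior

lemma IsLocalFrame.dim_pos (h : IsLocalFrame n (s * √d) θs p L) : 0 < d :=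
  Nat.pos_of_ne_zero fun hd => h.radius_pos.ne' (by simp [hd])

lemma IsLocalFrame.add_mem_nbhd (h : IsLocalFrame n (s * √d) θs p L)
    {x : EuclideanSpace ℝ (Fin d)} (hx : ‖x‖ ≤ √2 * (s * √d)) :
    p + L x ∈ nbhd n θs (2 * s) := by
  refine (h.wnorm_add_sub_le hx).trans_eq ?_
  rw [Real.sqrt_div (Nat.cast_nonneg d)]
  ring

/-- The logarithm, up to an additive constant, of the density of the posterior with respect to the
Gaussian approximation, in the coordinates `x` with `θ = p + L x`. -/
noncomputable def logDensity (n : ℕ) (p : EuclideanSpace ℝ (Fin d))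
    (L : EuclideanSpace ℝ (Fin d) ≃L[ℝ] EuclideanSpace ℝ (Fin d))
    (prior : EuclideanSpace ℝ (Fin d) → ℝ) (x : EuclideanSpace ℝ (Fin d)) : ℝ :=
  ‖x‖ ^ 2 / 2 - n * relEntropy p (p + L x) + Real.log (prior (p + L x))

/-- The derivative of `logDensity`. -/
noncomputable def logDensityDeriv (n : ℕ) (p : EuclideanSpace ℝ (Fin d))
    (L : EuclideanSpace ℝ (Fin d) ≃L[ℝ] EuclideanSpace ℝ (Fin d))
    (prior : EuclideanSpace ℝ (Fin d) → ℝ) (x : EuclideanSpace ℝ (Fin d)) :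
    EuclideanSpace ℝ (Fin d) →L[ℝ] ℝ :=
  innerSL ℝ x - (n : ℝ) • (fisherDual (p + L x) (L x)).comp L.toContinuousLinearMap +
    (innerSL ℝ (gradient (fun η => Real.log (prior η)) (p + L x))).comp L.toContinuousLinearMap

lemma hasFDerivAt_log_prior (h : IsLocalFrame n (s * √d) θs p L)
    (hp : IsRegularPrior n θs prior (2 * s) D) {x : EuclideanSpace ℝ (Fin d)}
    (hx : ‖x‖ ≤ √2 * (s * √d)) :
    HasFDerivAt (fun x => Real.log (prior (p + L x)))
      ((innerSL ℝ (gradient (fun η => Real.log (prior η)) (p + L x))).comp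
        L.toContinuousLinearMap) x :=
  HasFDerivAt.comp x (f := fun x => p + L x)
    (hp.hasGradientAt_log (h.add_mem_nbhd hx)).hasFDerivAt (L.hasFDerivAt.const_add p)

lemma hasFDerivAt_logDensity (h : IsLocalFrame n (s * √d) θs p L)
    (hp : IsRegularPrior n θs prior (2 * s) D) {x : EuclideanSpace ℝ (Fin d)}
    (hx : ‖x‖ ≤ √2 * (s * √d)) :
    HasFDerivAt (logDensity n p L prior) (logDensityDeriv n p L prior x) x := by
  have hquad : HasFDerivAt (fun x : EuclideanSpace ℝ (Fin d) => ‖x‖ ^ 2 / 2) (innerSL ℝ x) x :=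
    ((hasStrictFDerivAt_norm_sq x).hasFDerivAt.mul_const (2⁻¹ : ℝ)).congr_fderiv (by ext; simp)
  have hent := HasFDerivAt.comp x (f := fun x => p + L x)
    (hasFDerivAt_relEntropy p (h.add_mem hx)) (L.hasFDerivAt.const_add p)
  rw [add_sub_cancel_left] at hent
  exact (hquad.sub (hent.const_mul (n : ℝ))).add (hasFDerivAt_log_prior h hp hx)

lemma continuousOn_logDensity (h : IsLocalFrame n (s * √d) θs p L)
    (hp : IsRegularPrior n θs prior (2 * s) D) :
    ContinuousOn (logDensity n p L prior) (Metric.closedBall 0 (√2 * (s * √d))) := fun _ hx =>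
  (hasFDerivAt_logDensity h hp (mem_closedBall_zero_iff.1 hx)).continuousAt.continuousWithinAt

lemma continuousOn_logDensityDeriv (h : IsLocalFrame n (s * √d) θs p L)
    (hp : IsRegularPrior n θs prior (2 * s) D) :
    ContinuousOn (logDensityDeriv n p L prior) (Metric.closedBall 0 (√2 * (s * √d))) := by
  have hcont : ContinuousOn (fun x => p + L x) (Metric.closedBall 0 (√2 * (s * √d))) := by
    fun_prop
  have hent := (continuousOn_fisherDual_sub p).comp hcont fun x hx =>
    h.add_mem (mem_closedBall_zero_iff.1 hx)
  have hlog := hp.continuousOn_gradient_log.comp hcont fun x hx =>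
    h.add_mem_nbhd (mem_closedBall_zero_iff.1 hx)
  simp only [Function.comp_def, add_sub_cancel_left] at hent hlog
  exact ((by fun_prop : Continuous fun x => innerSL ℝ x).continuousOn.sub
    ((hent.clm_comp continuousOn_const).fun_const_smul (n : ℝ))).add
    (((innerSL ℝ).continuous.comp_continuousOn hlog).clm_comp continuousOn_const)

lemma norm_logDensityDeriv_le (h : IsLocalFrame n (s * √d) θs p L)
    (hp : IsRegularPrior n θs prior (2 * s) D) {x : EuclideanSpace ℝ (Fin d)}
    (hx : ‖x‖ ≤ √2 * (s * √d)) :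
    ‖logDensityDeriv n p L prior x‖ ≤ 4 * (s * √d / √(n * minProb θs)) * ‖x‖ + D / √n := by
  have hratio := h.ratio_nonneg
  have hD := hp.bound_nonneg
  refine ContinuousLinearMap.opNorm_le_bound _ (by positivity) fun v => ?_
  have hent := h.abs_mul_fisherInner_add_sub_le hx v
  have hlog := hp.abs_inner_gradient_le h.toIsFisherFrame h.n_pos (h.add_mem_nbhd hx) v
  rw [abs_sub_comm] at hent
  calc ‖logDensityDeriv n p L prior x v‖
      = |(⟪x, v⟫ - n * fisherInner (p + L x) (L x) (L v)) +
          ⟪gradient (fun η => Real.log (prior η)) (p + L x), L v⟫| := by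
        rw [← fisherDual_apply]; rfl
    _ ≤ 4 * (s * √d / √(n * minProb θs)) * (‖x‖ * ‖v‖) + D / √n * ‖v‖ :=
        (abs_add_le _ _).trans (add_le_add hent hlog)
    _ = _ := by ring

lemma lintegral_exp_logDensity_sub_le (h : IsLocalFrame n (s * √d) θs p L)
    (hp : IsRegularPrior n θs prior (2 * s) D)
    (hsmall : 640 * (s * d / √(n * minProb θs)) ^ 2 ≤ 1) :
    ∫⁻ z in Metric.closedBall (0 : EuclideanSpace ℝ (Fin d)) (s * √d) ×ˢ
        Metric.closedBall (0 : EuclideanSpace ℝ (Fin d)) (s * √d),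
      ENNReal.ofReal (Real.exp (2 * logDensity n p L prior z.1 - 2 * logDensity n p L prior z.2))
        ∂((stdGaussian _).prod (stdGaussian _)) ≤
      ENNReal.ofReal
        (Real.exp (320 * (s * d / √(n * minProb θs)) ^ 2 + 10 * (D / √n) ^ 2)) := by
  have hd1 : (1 : ℝ) ≤ d := by exact_mod_cast h.dim_pos
  have hdim : (s * √d / √(n * minProb θs)) ^ 2 * d = (s * d / √(n * minProb θs)) ^ 2 := by
    rw [div_pow, div_pow, mul_pow, Real.sq_sqrt (Nat.cast_nonneg d)]
    ring
  have hslope : 40 * (4 * (s * √d / √(n * minProb θs))) ^ 2 ≤ 1 := by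
    have hle := le_mul_of_one_le_right (sq_nonneg (s * √d / √(n * minProb θs))) hd1
    rw [mul_pow]
    linarith
  refine (lintegral_exp_two_mul_sub_le (f := logDensity n p L prior)
    (fun x hx => hasFDerivAt_logDensity h hp (mem_closedBall_zero_iff.1 hx))
    (continuousOn_logDensityDeriv h hp) hslope fun x hx =>
    norm_logDensityDeriv_le h hp (mem_closedBall_zero_iff.1 hx)).trans_eq ?_
  rw [finrank_euclideanSpace_fin, ← hdim]
  ring_nf

lemma abs_log_prior_sub_le (h : IsLocalFrame n (s * √d) θs p L)
    (hp : IsRegularPrior n θs prior (2 * s) D) {x y : EuclideanSpace ℝ (Fin d)}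
    (hx : ‖x‖ ≤ √2 * (s * √d)) (hy : ‖y‖ ≤ √2 * (s * √d)) :
    |Real.log (prior (p + L x)) - Real.log (prior (p + L y))| ≤ D / √n * ‖x - y‖ := by
  refine (convex_closedBall (0 : EuclideanSpace ℝ (Fin d))
    (√2 * (s * √d))).norm_image_sub_le_of_norm_hasFDerivWithin_le (𝕜 := ℝ)
    (f := fun x => Real.log (prior (p + L x)))
    (fun z hz => (hasFDerivAt_log_prior h hp (mem_closedBall_zero_iff.1 hz)).hasFDerivWithinAt)
    (fun z hz => ?_) (mem_closedBall_zero_iff.2 hy) (mem_closedBall_zero_iff.2 hx)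
  exact ContinuousLinearMap.opNorm_le_bound _ (div_nonneg hp.bound_nonneg (Real.sqrt_nonneg _))
    (hp.abs_inner_gradient_le h.toIsFisherFrame h.n_pos
      (h.add_mem_nbhd (mem_closedBall_zero_iff.1 hz)))

end Prior

section EuclideanIntegrals
variable {ι : Type*} [Fintype ι]

lemma integral_exp_neg_mul_abs {b : ℝ} (hb : 0 < b) : ∫ t : ℝ, Real.exp (-b * |t|) = 2 / b := by
  rw [integral_comp_abs (f := fun t => Real.exp (-b * t)), integral_exp_mul_Ioi (neg_lt_zero.2 hb),
    mul_zero, Real.exp_zero]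
  ring

lemma integrable_exp_neg_mul_abs {b : ℝ} (hb : 0 < b) :
    Integrable fun t : ℝ => Real.exp (-b * |t|) :=
  .of_integral_ne_zero (by rw [integral_exp_neg_mul_abs hb]; positivity)

lemma sum_abs_le_sqrt_card_mul_norm (x : EuclideanSpace ℝ ι) :
    ∑ i, |x i| ≤ √(Fintype.card ι) * ‖x‖ := by
  have hCS := Real.sum_mul_le_sqrt_mul_sqrt Finset.univ (fun _ : ι => (1 : ℝ)) fun i => |x i|
  rw [EuclideanSpace.norm_eq]
  simpa using hCS

lemma lintegral_exp_neg_mul_norm_le [Nonempty ι] {a : ℝ} (ha : 0 < a) :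
    ∫⁻ x : EuclideanSpace ℝ ι, ENNReal.ofReal (Real.exp (-a * ‖x‖)) ≤
      ENNReal.ofReal ((2 * √(Fintype.card ι) / a) ^ Fintype.card ι) := by
  have hcard : 0 < √(Fintype.card ι : ℝ) := Real.sqrt_pos.2 (by exact_mod_cast Fintype.card_pos)
  set b := a / √(Fintype.card ι) with hb_def
  have hb : 0 < b := div_pos ha hcard
  have hprod (x : ι → ℝ) :
      Real.exp (-a * ‖WithLp.toLp 2 x‖) ≤ ∏ i, Real.exp (-b * |x i|) := by
    have hle := mul_le_mul_of_nonneg_left (sum_abs_le_sqrt_card_mul_norm (WithLp.toLp 2 x)) hb.le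
    rw [← mul_assoc, div_mul_cancel₀ _ hcard.ne'] at hle
    rw [← Real.exp_sum, ← Finset.mul_sum, Real.exp_le_exp, neg_mul, neg_mul]
    exact neg_le_neg hle
  calc _ = ∫⁻ x : ι → ℝ, ENNReal.ofReal (Real.exp (-a * ‖WithLp.toLp 2 x‖)) :=
        ((PiLp.volume_preserving_toLp ι).lintegral_comp (by fun_prop)).symm
    _ ≤ ∫⁻ x : ι → ℝ, ENNReal.ofReal (∏ i, Real.exp (-b * |x i|)) :=
        lintegral_mono fun x => ENNReal.ofReal_le_ofReal (hprod x)
    _ = ENNReal.ofReal (∫ x : ι → ℝ, ∏ i, Real.exp (-b * |x i|)) := by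
        refine (ofReal_integral_eq_lintegral_ofReal ?_ (ae_of_all _ fun x => ?_)).symm
        · exact Integrable.fintype_prod (f := fun _ t => Real.exp (-b * |t|))
            fun _ => integrable_exp_neg_mul_abs hb
        · exact Finset.prod_nonneg fun _ _ => (Real.exp_pos _).le
    _ = _ := by
        rw [integral_fintype_prod_volume_eq_pow fun t => Real.exp (-b * |t|),
          integral_exp_neg_mul_abs hb, hb_def, div_div_eq_mul_div]

lemma volume_unitCube : volume {x : EuclideanSpace ℝ ι | ∀ i, |x i| ≤ 1 / 2} = 1 := by
  have hpre : (@WithLp.toLp 2 (ι → ℝ)) ⁻¹' {x | ∀ i, |x i| ≤ 1 / 2} =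
      Set.Icc (fun _ => -(1 / 2)) (fun _ => 1 / 2) := by
    ext x
    simp [abs_le, Set.mem_Icc, Pi.le_def, forall_and]
  rw [← (PiLp.volume_preserving_toLp ι).measure_preimage_emb
    (MeasurableEquiv.toLp 2 (ι → ℝ)).measurableEmbedding, hpre, Real.volume_Icc_pi]
  norm_num

lemma measurableSet_unitCube {κ : Type*} [Countable κ] :
    MeasurableSet {x : EuclideanSpace ℝ κ | ∀ i, |x i| ≤ 1 / 2} := by
  rw [Set.ofPred_forall]
  exact .iInter fun i => measurableSet_le (by fun_prop) measurable_const

lemma norm_le_of_mem_unitCube {x : EuclideanSpace ℝ ι} (hx : ∀ i, |x i| ≤ 1 / 2) :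
    ‖x‖ ≤ √(Fintype.card ι) / 2 := by
  have hsq : ‖x‖ ^ 2 ≤ Fintype.card ι / 4 := by
    rw [EuclideanSpace.norm_sq_eq]
    calc ∑ i, ‖x i‖ ^ 2 ≤ ∑ _i : ι, (1 / 2 : ℝ) ^ 2 :=
          Finset.sum_le_sum fun i _ => pow_le_pow_left₀ (norm_nonneg _) (hx i) 2
      _ = _ := by rw [Finset.sum_const, Finset.card_univ, nsmul_eq_mul]; ring
  refine le_of_sq_le_sq (hsq.trans_eq ?_) (by positivity)
  rw [div_pow, Real.sq_sqrt (Nat.cast_nonneg _)]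
  norm_num

lemma exists_map_add_linearEquiv_eq_smul {E : Type*} [NormedAddCommGroup E] [NormedSpace ℝ E]
    [FiniteDimensional ℝ E] [MeasurableSpace E] [BorelSpace E] (μ : Measure E)
    [μ.IsAddHaarMeasure] (p : E) (L : E ≃L[ℝ] E) :
    ∃ k : ENNReal, k ≠ 0 ∧ k ≠ ⊤ ∧ μ.map (fun x => p + L x) = k • μ := by
  have hdet : LinearMap.det (L : E →ₗ[ℝ] E) ≠ 0 := L.toLinearEquiv.isUnit_det'.ne_zero
  refine ⟨ENNReal.ofReal |(LinearMap.det (L : E →ₗ[ℝ] E))⁻¹|, by simpa using hdet,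
    ENNReal.ofReal_ne_top, ?_⟩
  have hmap : μ.map L = ENNReal.ofReal |(LinearMap.det (L : E →ₗ[ℝ] E))⁻¹| • μ :=
    Measure.map_linearMap_addHaar_eq_smul_addHaar μ hdet
  change μ.map ((fun x => p + x) ∘ L) = _
  rw [← Measure.map_map (by fun_prop) (by fun_prop), hmap, Measure.map_smul, map_add_left_eq_self]

end EuclideanIntegrals

section LocalPosterior
open scoped ENNReal
variable {d n : ℕ} {prior : EuclideanSpace ℝ (Fin d) → ℝ}

/-- The posterior, up to normalization, in the coordinates `x` with `θ = p + L x`. -/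
noncomputable def localPosterior (n : ℕ) (p : EuclideanSpace ℝ (Fin d))
    (L : EuclideanSpace ℝ (Fin d) ≃L[ℝ] EuclideanSpace ℝ (Fin d))
    (prior : EuclideanSpace ℝ (Fin d) → ℝ) : Measure (EuclideanSpace ℝ (Fin d)) :=
  (volume.restrict {x | p + L x ∈ paramSpace d}).withDensity fun x =>
    ENNReal.ofReal (Real.exp (-(n * relEntropy p (p + L x))) * prior (p + L x))

lemma posteriorWeight_apply (hn : 0 < n) {N : Fin (d + 1) → ℕ} (hN : ∑ j, N j = n)
    (prior : EuclideanSpace ℝ (Fin d) → ℝ) {A : Set (EuclideanSpace ℝ (Fin d))}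
    (hA : MeasurableSet A) :
    posteriorWeight n prior N A =
      ENNReal.ofReal (Real.exp (-(n * negLogLik n N (freq n N)))) *
        ∫⁻ θ in A ∩ paramSpace d,
          ENNReal.ofReal (Real.exp (-(n * relEntropy (freq n N) θ)) * prior θ) := by
  rw [posteriorWeight, withDensity_apply _ hA, Measure.restrict_restrict hA,
    ← lintegral_const_mul' _ _ ENNReal.ofReal_ne_top]
  refine lintegral_congr fun θ => ?_
  rw [← ENNReal.ofReal_mul (Real.exp_pos _).le, ← mul_assoc, ← Real.exp_add,
    negLogLik_eq_add_relEntropy hn hN θ, mul_add, neg_add]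

lemma exists_posteriorWeight_eq_smul_map (hn : 0 < n) {N : Fin (d + 1) → ℕ} (hN : ∑ j, N j = n)
    (L : EuclideanSpace ℝ (Fin d) ≃L[ℝ] EuclideanSpace ℝ (Fin d))
    (prior : EuclideanSpace ℝ (Fin d) → ℝ) :
    ∃ c : ℝ≥0∞, c ≠ 0 ∧ c ≠ ∞ ∧ posteriorWeight n prior N =
      c • (localPosterior n (freq n N) L prior).map fun x => freq n N + L x := by
  set p := freq n N
  set w := ENNReal.ofReal (Real.exp (-(n * negLogLik n N p)))
  obtain ⟨k, hk, hk', hmap⟩ := exists_map_add_linearEquiv_eq_smul volume p L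
  let e := (L.toHomeomorph.trans (Homeomorph.addLeft p)).toMeasurableEquiv
  change volume.map e = k • volume at hmap
  refine ⟨w * k⁻¹, mul_ne_zero (by simp [w, Real.exp_pos]) (ENNReal.inv_ne_zero.2 hk'),
    ENNReal.mul_ne_top ENNReal.ofReal_ne_top (ENNReal.inv_ne_top.2 hk), ?_⟩
  ext A hA
  have hlocal : (localPosterior n p L prior).map e A = k * ∫⁻ θ in A ∩ paramSpace d,
      ENNReal.ofReal (Real.exp (-(n * relEntropy p θ)) * prior θ) := by
    have hset : e ⁻¹' A ∩ {x | p + L x ∈ paramSpace d} = e ⁻¹' (A ∩ paramSpace d) := rfl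
    rw [e.map_apply, localPosterior, withDensity_apply _ (e.measurable hA),
      Measure.restrict_restrict (e.measurable hA), hset, ← smul_eq_mul, ← lintegral_smul_measure,
      ← Measure.restrict_smul, ← hmap, e.restrict_map, lintegral_map_equiv]
    rfl
  change posteriorWeight n prior N A = (w * k⁻¹) * (localPosterior n p L prior).map e A
  rw [hlocal, posteriorWeight_apply hn hN prior hA, mul_assoc, ENNReal.inv_mul_cancel_left hk hk']

lemma posterior_eq_map (hn : 0 < n) {N : Fin (d + 1) → ℕ} (hN : ∑ j, N j = n)
    (L : EuclideanSpace ℝ (Fin d) ≃L[ℝ] EuclideanSpace ℝ (Fin d))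
    (prior : EuclideanSpace ℝ (Fin d) → ℝ) :
    posterior n prior N =
      (localPosterior n (freq n N) L prior)[|.univ].map fun x => freq n N + L x := by
  obtain ⟨c, hc, hc', hweight⟩ := exists_posteriorWeight_eq_smul_map hn hN L prior
  have hmeas : Measurable fun x => freq n N + L x := by fun_prop
  rw [← cond_smul _ _ hc hc', ProbabilityTheory.cond, Measure.restrict_univ, Measure.map_smul,
    Measure.map_smul, ← hweight, posterior, hweight, Measure.smul_apply, Measure.smul_apply,
    Measure.map_apply hmeas .univ, Set.preimage_univ]

lemma negLogLik_nonneg (n : ℕ) (N : Fin (d + 1) → ℕ) {θ : EuclideanSpace ℝ (Fin d)}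
    (hθ : θ ∈ paramSpace d) : 0 ≤ negLogLik n N θ := by
  refine neg_nonneg.2 (Finset.sum_nonpos fun j _ => ?_)
  have hle : full θ j ≤ 1 := sum_full θ ▸
    Finset.single_le_sum (fun i _ => (full_pos hθ i).le) (Finset.mem_univ j)
  exact mul_nonpos_of_nonneg_of_nonpos (by positivity) (Real.log_nonpos (full_pos hθ j).le hle)

lemma isFiniteMeasure_posteriorWeight (hprior : ∀ θ ∈ paramSpace d, 0 ≤ prior θ)
    (hint : IntegrableOn prior (paramSpace d) volume) (N : Fin (d + 1) → ℕ) :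
    IsFiniteMeasure (posteriorWeight n prior N) := by
  refine isFiniteMeasure_withDensity (((setLIntegral_mono' isOpen_paramSpace.measurableSet
    fun θ hθ => ENNReal.ofReal_le_ofReal ?_).trans_lt hint.lintegral_lt_top).ne)
  refine mul_le_of_le_one_left (hprior θ hθ) (Real.exp_le_one_iff.2 ?_)
  exact neg_nonpos.2 (mul_nonneg (Nat.cast_nonneg n) (negLogLik_nonneg n N hθ))

lemma isFiniteMeasure_localPosterior (hn : 0 < n) {N : Fin (d + 1) → ℕ} (hN : ∑ j, N j = n)
    (L : EuclideanSpace ℝ (Fin d) ≃L[ℝ] EuclideanSpace ℝ (Fin d))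
    (hprior : ∀ θ ∈ paramSpace d, 0 ≤ prior θ)
    (hint : IntegrableOn prior (paramSpace d) volume) :
    IsFiniteMeasure (localPosterior n (freq n N) L prior) := by
  obtain ⟨c, hc, -, hweight⟩ := exists_posteriorWeight_eq_smul_map hn hN L prior
  have hfin := (isFiniteMeasure_posteriorWeight (n := n) hprior hint N).measure_univ_lt_top
  rw [hweight, Measure.smul_apply, Measure.map_apply (by fun_prop) .univ, smul_eq_mul,
    Set.preimage_univ] at hfin
  exact ⟨ENNReal.lt_top_of_mul_ne_top_right hfin.ne hc⟩

end LocalPosterior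

section LocalMass
open scoped ENNReal
variable {d n : ℕ} {s D : ℝ} {θs p : EuclideanSpace ℝ (Fin d)}
  {L : EuclideanSpace ℝ (Fin d) ≃L[ℝ] EuclideanSpace ℝ (Fin d)}
  {prior : EuclideanSpace ℝ (Fin d) → ℝ}

lemma le_sqrt_two_mul {a R : ℝ} (hR : 0 ≤ R) (ha : a ≤ R) : a ≤ √2 * R :=
  ha.trans (le_mul_of_one_le_left hR (Real.one_le_sqrt.2 one_le_two))

lemma exp_logDensity_eq {x : EuclideanSpace ℝ (Fin d)} (hx : 0 < prior (p + L x)) :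
    Real.exp (-(1 / 2) * ‖x‖ ^ 2) * Real.exp (logDensity n p L prior x) =
      Real.exp (-(n * relEntropy p (p + L x))) * prior (p + L x) := by
  rw [← Real.exp_log hx, ← Real.exp_add, ← Real.exp_add, logDensity]
  ring_nf

lemma exists_localPosterior_restrict_eq (h : IsLocalFrame n (s * √d) θs p L)
    (hp : IsRegularPrior n θs prior (2 * s) D) :
    ∃ c : ℝ≥0∞, c ≠ 0 ∧ c ≠ ∞ ∧
      (localPosterior n p L prior).restrict (Metric.closedBall 0 (s * √d)) =
        c • ((stdGaussian _).restrict (Metric.closedBall 0 (s * √d))).withDensity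
          fun x => ENNReal.ofReal (Real.exp (logDensity n p L prior x)) := by
  set B := Metric.closedBall (0 : EuclideanSpace ℝ (Fin d)) (s * √d)
  have hB : MeasurableSet B := Metric.isClosed_closedBall.measurableSet
  have hBx : ∀ x ∈ B, ‖x‖ ≤ √2 * (s * √d) := fun x hx =>
    le_sqrt_two_mul h.radius_pos.le (mem_closedBall_zero_iff.1 hx)
  have hBmem : B ⊆ {x | p + L x ∈ paramSpace d} := fun x hx => h.add_mem (hBx x hx)
  set κ := (2 * Real.pi) ^ (-((d : ℝ) / 2))
  have hκ : 0 < κ := by positivity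
  have hmeas : AEMeasurable (logDensity n p L prior) (volume.restrict B) :=
    ((continuousOn_logDensity h hp).mono fun x hx =>
      mem_closedBall_zero_iff.2 (hBx x hx)).aemeasurable hB
  refine ⟨ENNReal.ofReal κ⁻¹, by simpa using hκ, ENNReal.ofReal_ne_top, ?_⟩
  rw [stdGaussian_eq_withDensity, finrank_euclideanSpace_fin, restrict_withDensity hB,
    localPosterior, restrict_withDensity hB, Measure.restrict_restrict hB,
    Set.inter_eq_left.2 hBmem, ← withDensity_mul₀ (by fun_prop) (by fun_prop),
    ← withDensity_smul' _ _ ENNReal.ofReal_ne_top]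
  refine withDensity_congr_ae ?_
  filter_upwards [ae_restrict_mem hB] with x hx
  simp only [Pi.smul_apply, Pi.mul_apply, smul_eq_mul]
  rw [← exp_logDensity_eq (hp.pos _ (h.add_mem_nbhd (hBx x hx))),
    ← ENNReal.ofReal_mul (by positivity), ← ENNReal.ofReal_mul (by positivity), mul_assoc κ,
    inv_mul_cancel_left₀ hκ.ne']

lemma IsLocalFrame.norm_symm_sub_le {R : ℝ} (h : IsLocalFrame n R θs p L) :
    ‖L.symm (θs - p)‖ ≤ R / 2 := by
  rw [← norm_neg, ← map_neg, neg_sub]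
  exact h.close

lemma IsLocalFrame.prior_pos (h : IsLocalFrame n (s * √d) θs p L)
    (hp : IsRegularPrior n θs prior (2 * s) D) :
    0 < prior θs := by
  have hmem := h.add_mem_nbhd (x := L.symm (θs - p))
    (le_sqrt_two_mul h.radius_pos.le (by linarith [h.norm_symm_sub_le, h.radius_pos]))
  rw [L.apply_symm_apply, add_sub_cancel] at hmem
  exact hp.pos _ hmem

lemma le_exp_neg_relEntropy_mul_prior (h : IsLocalFrame n (s * √d) θs p L)
    (hp : IsRegularPrior n θs prior (2 * s) D) (hD : D ≤ √(n * d) / 6) (hs : 1 ≤ s)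
    {x : EuclideanSpace ℝ (Fin d)} (hx : ‖x‖ ≤ √d / 2) :
    prior θs * Real.exp (-(d + d * s / 6)) ≤
      Real.exp (-(n * relEntropy p (p + L x))) * prior (p + L x) := by
  have hR := h.radius_pos
  have hdR : √d ≤ s * √d := le_mul_of_one_le_left (Real.sqrt_nonneg _) hs
  set y := L.symm (θs - p) with hy_def
  have hy : ‖y‖ ≤ s * √d / 2 := h.norm_symm_sub_le
  have hxR : ‖x‖ ≤ √2 * (s * √d) := le_sqrt_two_mul hR.le (by linarith)
  have hentropy : n * relEntropy p (p + L x) ≤ d := by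
    have hsq := pow_le_pow_left₀ (norm_nonneg x) hx 2
    rw [div_pow, Real.sq_sqrt (Nat.cast_nonneg d)] at hsq
    linarith [(h.relEntropy_bounds hxR).2]
  have hlog : Real.log (prior θs) - d * s / 6 ≤ Real.log (prior (p + L x)) := by
    have hLip := abs_log_prior_sub_le h hp hxR (le_sqrt_two_mul hR.le (by linarith : ‖y‖ ≤ _))
    rw [hy_def, L.apply_symm_apply, add_sub_cancel, ← hy_def] at hLip
    have hslope : D / √n ≤ √d / 6 := by
      rw [div_le_iff₀ (Real.sqrt_pos.2 h.n_pos_real)]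
      rw [Real.sqrt_mul (Nat.cast_nonneg n)] at hD
      linarith
    have hbound : D / √n * ‖x - y‖ ≤ √d / 6 * (s * √d) :=
      mul_le_mul hslope ((norm_sub_le x y).trans (by linarith)) (norm_nonneg _) (by positivity)
    have hdsq : √d * √d = d := Real.mul_self_sqrt (Nat.cast_nonneg d)
    linear_combination (abs_le.1 hLip).1 + hbound + s / 6 * hdsq
  have hpos := hp.pos _ (h.add_mem_nbhd hxR)
  rw [← Real.exp_log (h.prior_pos hp), ← Real.exp_log hpos, ← Real.exp_add, ← Real.exp_add]
  exact Real.exp_le_exp.2 (by linarith)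

lemma le_localPosterior_univ (h : IsLocalFrame n (s * √d) θs p L)
    (hp : IsRegularPrior n θs prior (2 * s) D) (hD : D ≤ √(n * d) / 6) (hs : 1 ≤ s) :
    ENNReal.ofReal (prior θs * Real.exp (-(d + d * s / 6))) ≤
      localPosterior n p L prior .univ := by
  set Q := {x : EuclideanSpace ℝ (Fin d) | ∀ i, |x i| ≤ 1 / 2}
  have hQ : MeasurableSet Q := measurableSet_unitCube
  have hnorm (x) (hx : x ∈ Q) : ‖x‖ ≤ √d / 2 :=
    (norm_le_of_mem_unitCube hx).trans_eq (by rw [Fintype.card_fin])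
  have hQmem : Q ⊆ {x | p + L x ∈ paramSpace d} := fun x hx =>
    h.add_mem (le_sqrt_two_mul h.radius_pos.le ((hnorm x hx).trans (by
      nlinarith [Real.sqrt_nonneg (d : ℝ)])))
  calc _ = ∫⁻ _x in Q, ENNReal.ofReal (prior θs * Real.exp (-(d + d * s / 6))) := by
        rw [setLIntegral_const, volume_unitCube, mul_one]
    _ ≤ ∫⁻ x in Q, ENNReal.ofReal (Real.exp (-(n * relEntropy p (p + L x))) * prior (p + L x)) :=
        setLIntegral_mono' hQ fun x hx =>
          ENNReal.ofReal_le_ofReal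
            (le_exp_neg_relEntropy_mul_prior h hp hD hs (hnorm x hx))
    _ = localPosterior n p L prior Q := by
        rw [localPosterior, withDensity_apply _ hQ, Measure.restrict_restrict hQ,
          Set.inter_eq_left.2 hQmem]
    _ ≤ _ := measure_mono (Set.subset_univ _)

lemma IsLocalFrame.neZero_localPosterior (h : IsLocalFrame n (s * √d) θs p L)
    (hp : IsRegularPrior n θs prior (2 * s) D) (hD : D ≤ √(n * d) / 6) (hs : 1 ≤ s) :
    NeZero (localPosterior n p L prior) := by
  have hpos := h.prior_pos hp
  refine ⟨fun hzero => ?_⟩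
  have hle := le_localPosterior_univ h hp hD hs
  rw [hzero, Measure.coe_zero, Pi.zero_apply, nonpos_iff_eq_zero, ENNReal.ofReal_eq_zero] at hle
  exact hle.not_gt (by positivity)

lemma exp_neg_relEntropy_mul_prior_le (h : IsLocalFrame n (s * √d) θs p L) {S : ℝ}
    (hS : ∀ θ ∈ paramSpace d, prior θ ≤ S) (hS₀ : 0 ≤ S) {x : EuclideanSpace ℝ (Fin d)}
    (hx : s * √d ≤ ‖x‖) (hmem : p + L x ∈ paramSpace d) :
    Real.exp (-(n * relEntropy p (p + L x))) * prior (p + L x) ≤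
      S * Real.exp (-(d * s ^ 2 / 24)) * Real.exp (-(s * √d / 24) * ‖x‖) := by
  have hgrowth := h.linear_growth hx hmem
  have hsq : s * √d * (s * √d) = d * s ^ 2 := by
    rw [mul_mul_mul_comm, Real.mul_self_sqrt (Nat.cast_nonneg d)]
    ring
  have hnorm := mul_le_mul_of_nonneg_left hx h.radius_pos.le
  rw [mul_assoc, ← Real.exp_add]
  refine (mul_le_mul_of_nonneg_left (hS _ hmem) (Real.exp_pos _).le).trans ?_
  rw [mul_comm S]
  exact mul_le_mul_of_nonneg_right (Real.exp_le_exp.2 (by linarith)) hS₀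

lemma localPosterior_closedBall_compl_le (h : IsLocalFrame n (s * √d) θs p L) (hs : 48 ≤ s)
    {S : ℝ} (hS : ∀ θ ∈ paramSpace d, prior θ ≤ S) (hS₀ : 0 ≤ S) :
    localPosterior n p L prior (Metric.closedBall 0 (s * √d))ᶜ ≤
      ENNReal.ofReal (S * Real.exp (-(d * s ^ 2 / 24))) := by
  have hR := h.radius_pos
  have : Nonempty (Fin d) := ⟨⟨0, h.dim_pos⟩⟩
  have hmem : MeasurableSet {x | p + L x ∈ paramSpace d} :=
    (isOpen_paramSpace.preimage (by fun_prop : Continuous fun x => p + L x)).measurableSet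
  have hB : MeasurableSet (Metric.closedBall (0 : EuclideanSpace ℝ (Fin d)) (s * √d))ᶜ :=
    Metric.isClosed_closedBall.measurableSet.compl
  have hratio : (2 * √d / (s * √d / 24)) ^ d ≤ 1 := by
    refine pow_le_one₀ (by positivity) ((div_le_one (by positivity)).2 ?_)
    nlinarith [Real.sqrt_nonneg (d : ℝ)]
  rw [localPosterior, withDensity_apply _ hB, Measure.restrict_restrict hB]
  calc _ ≤ ∫⁻ x in (Metric.closedBall 0 (s * √d))ᶜ ∩ {x | p + L x ∈ paramSpace d},
          ENNReal.ofReal (S * Real.exp (-(d * s ^ 2 / 24))) *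
            ENNReal.ofReal (Real.exp (-(s * √d / 24) * ‖x‖)) := by
        refine setLIntegral_mono' (hB.inter hmem) fun x hx => ?_
        rw [← ENNReal.ofReal_mul (by positivity)]
        refine ENNReal.ofReal_le_ofReal (exp_neg_relEntropy_mul_prior_le h hS hS₀ ?_ hx.2)
        simpa using (not_le.1 (mt mem_closedBall_zero_iff.2 hx.1)).le
    _ ≤ ∫⁻ x, ENNReal.ofReal (S * Real.exp (-(d * s ^ 2 / 24))) *
          ENNReal.ofReal (Real.exp (-(s * √d / 24) * ‖x‖)) := setLIntegral_le_lintegral _ _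
    _ ≤ ENNReal.ofReal (S * Real.exp (-(d * s ^ 2 / 24))) *
          ENNReal.ofReal ((2 * √d / (s * √d / 24)) ^ d) := by
        rw [lintegral_const_mul _ (by fun_prop)]
        gcongr
        simpa using lintegral_exp_neg_mul_norm_le (ι := Fin d) (a := s * √d / 24) (by positivity)
    _ ≤ _ := mul_le_of_le_one_right (by positivity) (ENNReal.ofReal_le_one.2 hratio)

end LocalMass

section PosteriorApproximation
open scoped ENNReal
variable {d n : ℕ} {s D S : ℝ} {θs p : EuclideanSpace ℝ (Fin d)}
  {L : EuclideanSpace ℝ (Fin d) ≃L[ℝ] EuclideanSpace ℝ (Fin d)}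
  {prior : EuclideanSpace ℝ (Fin d) → ℝ}

lemma localPosterior_compl_div_univ_le (h : IsLocalFrame n (s * √d) θs p L)
    (hp : IsRegularPrior n θs prior (2 * s) D) (hD : D ≤ √(n * d) / 6) (hs : 48 ≤ s)
    (hS : ∀ θ ∈ paramSpace d, prior θ ≤ S) :
    localPosterior n p L prior (Metric.closedBall 0 (s * √d))ᶜ / localPosterior n p L prior .univ ≤
      ENNReal.ofReal (S / prior θs * Real.exp (-(1 / 128 * d * s ^ 2))) := by
  have hpos := h.prior_pos hp
  have hS₀ : 0 ≤ S := hpos.le.trans (hS θs h.mem)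
  refine (ENNReal.div_le_div (localPosterior_closedBall_compl_le h hs hS hS₀)
    (le_localPosterior_univ h hp hD (by linarith))).trans ?_
  rw [← ENNReal.ofReal_div_of_pos (by positivity), mul_div_mul_comm, ← Real.exp_sub]
  refine ENNReal.ofReal_le_ofReal (mul_le_mul_of_nonneg_left (Real.exp_le_exp.2 ?_) (by positivity))
  have hexp : 0 ≤ d * (s ^ 2 / 24 - s ^ 2 / 128 - 1 - s / 6) :=
    mul_nonneg (Nat.cast_nonneg d) (by nlinarith)
  linarith

lemma stdGaussian_closedBall_compl_le_sq (d : ℕ) (hs : 2 ≤ s) :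
    stdGaussian (EuclideanSpace ℝ (Fin d)) (Metric.closedBall 0 (s * √d))ᶜ ≤
      ENNReal.ofReal (Real.exp (-(1 / 128 * d * s ^ 2)) ^ 2) := by
  refine (stdGaussian_closedBall_compl_le (by positivity)).trans (ENNReal.ofReal_le_ofReal ?_)
  rw [← Real.exp_nat_mul, finrank_euclideanSpace_fin, mul_pow, Real.sq_sqrt (Nat.cast_nonneg d)]
  refine Real.exp_le_exp.2 ?_
  have hexp : 0 ≤ d * (s ^ 2 / 4 - s ^ 2 / 64 - 1 / 2) :=
    mul_nonneg (Nat.cast_nonneg d) (by nlinarith)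
  push_cast
  linarith

lemma one_sub_sq_le_stdGaussian_closedBall (d : ℕ) (hs : 2 ≤ s) :
    1 - Real.exp (-(1 / 128 * d * s ^ 2)) ^ 2 ≤
      (stdGaussian (EuclideanSpace ℝ (Fin d))).real (Metric.closedBall 0 (s * √d)) := by
  have hcompl := ENNReal.toReal_le_of_le_ofReal (sq_nonneg _)
    (stdGaussian_closedBall_compl_le_sq d hs)
  rw [← measureReal_def, probReal_compl_eq_one_sub Metric.isClosed_closedBall.measurableSet]
    at hcompl
  linarith

lemma one_div_one_sub_sq_le_exp {t : ℝ} (ht : 0 ≤ t) (ht' : t ≤ 1 / 2) :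
    1 / (1 - t) ^ 2 ≤ Real.exp (4 * t) := by
  have hone : 1 ≤ Real.exp (2 * t) * (1 - t) := by
    nlinarith [mul_le_mul_of_nonneg_right (Real.add_one_le_exp (2 * t)) (by linarith : 0 ≤ 1 - t)]
  rw [div_le_iff₀ (by nlinarith)]
  calc (1 : ℝ) ≤ (Real.exp (2 * t) * (1 - t)) ^ 2 := one_le_pow₀ hone
    _ = _ := by rw [mul_pow, ← Real.exp_nat_mul]; push_cast; ring_nf

lemma sqrt_exp_div_sq_sub_one_le {a b g τ : ℝ} (ha : 0 ≤ a) (hb : 0 ≤ b) (hτ : 0 ≤ τ)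
    (hg : 1 - τ ^ 2 ≤ g) (hle : 320 * a ^ 2 + 10 * b ^ 2 + 4 * τ ^ 2 ≤ 1) :
    √(Real.exp (320 * a ^ 2 + 10 * b ^ 2) / g ^ 2 - 1) ≤ 26 * a + 5 * b + 3 * τ := by
  set v := 320 * a ^ 2 + 10 * b ^ 2 + 4 * τ ^ 2
  have hv : 0 ≤ v := by positivity
  have hτ_small : τ ^ 2 ≤ 1 / 2 := by nlinarith
  have hexp : Real.exp (320 * a ^ 2 + 10 * b ^ 2) / g ^ 2 ≤ Real.exp v := by
    have hinv : 1 / g ^ 2 ≤ 1 / (1 - τ ^ 2) ^ 2 :=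
      one_div_le_one_div_of_le (by nlinarith) (pow_le_pow_left₀ (by linarith) hg 2)
    rw [div_eq_mul_one_div, Real.exp_add (320 * a ^ 2 + 10 * b ^ 2)]
    exact mul_le_mul_of_nonneg_left
      (hinv.trans (one_div_one_sub_sq_le_exp (sq_nonneg τ) hτ_small)) (Real.exp_pos _).le
  have hexp_sub : Real.exp v - 1 ≤ 2 * v := by
    have habs := (abs_le.1 (Real.abs_exp_sub_one_le (by rwa [abs_of_nonneg hv]))).2
    rwa [abs_of_nonneg hv] at habs
  refine Real.sqrt_le_iff.2 ⟨by positivity, ?_⟩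
  nlinarith [mul_nonneg ha hb, mul_nonneg ha hτ, mul_nonneg hb hτ]

lemma tv_localPosterior_le_of_small (h : IsLocalFrame n (s * √d) θs p L)
    (hp : IsRegularPrior n θs prior (2 * s) D) (hD : D ≤ √(n * d) / 6) (hs : 48 ≤ s)
    (hS : ∀ θ ∈ paramSpace d, prior θ ≤ S)
    [IsFiniteMeasure (localPosterior n p L prior)] [NeZero (localPosterior n p L prior)]
    (hsmall : s * d / √(n * minProb θs) + D / √n +
      S / prior θs * Real.exp (-(1 / 128 * d * s ^ 2)) ≤ 1 / 40) :
    tv (localPosterior n p L prior)[|.univ] (stdGaussian _) ≤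
      ENNReal.ofReal (40 * (s * d / √(n * minProb θs) + D / √n +
        S / prior θs * Real.exp (-(1 / 128 * d * s ^ 2)))) := by
  set B := Metric.closedBall (0 : EuclideanSpace ℝ (Fin d)) (s * √d)
  have hB : MeasurableSet B := Metric.isClosed_closedBall.measurableSet
  obtain ⟨c, hc, hc', hν⟩ := exists_localPosterior_restrict_eq h hp
  have hf : AEMeasurable (logDensity n p L prior) ((stdGaussian _).restrict B) :=
    ((continuousOn_logDensity h hp).mono (Metric.closedBall_subset_closedBall
      (le_sqrt_two_mul h.radius_pos.le le_rfl))).aemeasurable hB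
  have hratio := localPosterior_compl_div_univ_le h hp hD hs hS
  have htail := stdGaussian_closedBall_compl_le_sq d (s := s) (by linarith)
  have hγB := one_sub_sq_le_stdGaussian_closedBall d (s := s) (by linarith)
  have hε : 0 ≤ s * d / √(n * minProb θs) := by positivity
  have hδ : 0 ≤ D / √n := div_nonneg hp.bound_nonneg (Real.sqrt_nonneg _)
  set δ := D / √n
  set ε := s * d / √(n * minProb θs)
  set τ := Real.exp (-(1 / 128 * d * s ^ 2))
  have hτ : 0 ≤ τ := (Real.exp_pos _).le
  have hτT : τ ≤ S / prior θs * τ :=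
    le_mul_of_one_le_left hτ ((one_le_div (h.prior_pos hp)).2 (hS θs h.mem))
  set T := S / prior θs * τ
  have hγB₀ : stdGaussian _ B ≠ 0 := (measureReal_ne_zero_iff).1 (by nlinarith)
  refine (tv_normalized_le hB hγB₀ hf hc hc' hν
    (lintegral_exp_logDensity_sub_le h hp (by nlinarith))).trans ((add_le_add (add_le_add hratio
    (ENNReal.ofReal_le_ofReal (sqrt_exp_div_sq_sub_one_le hε hδ hτ hγB (by nlinarith))))
    htail).trans ?_)
  rw [← ENNReal.ofReal_add (hτ.trans hτT) (by positivity),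
    ← ENNReal.ofReal_add (by linarith) (by positivity)]
  exact ENNReal.ofReal_le_ofReal (by nlinarith)

lemma tv_localPosterior_le (h : IsLocalFrame n (s * √d) θs p L)
    (hp : IsRegularPrior n θs prior (2 * s) D) (hD : D ≤ √(n * d) / 6) (hs : 48 ≤ s)
    (hS : ∀ θ ∈ paramSpace d, prior θ ≤ S)
    [IsFiniteMeasure (localPosterior n p L prior)] [NeZero (localPosterior n p L prior)] :
    tv (localPosterior n p L prior)[|.univ] (stdGaussian _) ≤
      ENNReal.ofReal (40 * (s * d / √(n * minProb θs) + D / √n +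
        S / prior θs * Real.exp (-(1 / 128 * d * s ^ 2)))) := by
  rcases le_total (s * d / √(n * minProb θs) + D / √n +
    S / prior θs * Real.exp (-(1 / 128 * d * s ^ 2))) (1 / 40) with hsmall | hlarge
  · exact tv_localPosterior_le_of_small h hp hD hs hS hsmall
  · have : IsProbabilityMeasure (localPosterior n p L prior)[|.univ] :=
      cond_isProbabilityMeasure (NeZero.ne _)
    exact (tv_le_one _ _).trans (ENNReal.one_le_ofReal.2 (by linarith))

lemma exp_mul_log_div_sub {d : ℕ} (hd : d ≠ 0) (x : ℝ≥0∞) (c : ℝ) :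
    EReal.exp ((d : EReal) * (ENNReal.log x / (d : EReal) - (c : EReal))) =
      x * ENNReal.ofReal (Real.exp (-(d * c))) := by
  rw [sub_eq_add_neg, EReal.exp_nmul, EReal.exp_add, mul_pow, ← EReal.exp_nmul,
    EReal.mul_div_cancel (EReal.natCast_ne_bot d) (EReal.natCast_ne_top d) (by exact_mod_cast hd),
    ENNReal.exp_log, ← EReal.coe_neg, EReal.exp_coe, ← ENNReal.ofReal_pow (Real.exp_pos _).le,
    ← Real.exp_nat_mul, mul_neg]

lemma tv_localPosterior_le_exp_M0 (h : IsLocalFrame n (s * √d) θs p L)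
    (hp : IsRegularPrior n θs prior (2 * s) D) (hD : D ≤ √(n * d) / 6) (hs : 48 ≤ s)
    [IsFiniteMeasure (localPosterior n p L prior)] [NeZero (localPosterior n p L prior)] :
    tv (localPosterior n p L prior)[|.univ] (stdGaussian _) ≤
      ENNReal.ofReal 40 * (ENNReal.ofReal (s * d / √(n * minProb θs)) + ENNReal.ofReal (D / √n) +
        EReal.exp ((d : EReal) * (M0 θs prior - ((1 / 128 * s ^ 2 : ℝ) : EReal)))) := by
  have hpos := h.prior_pos hp
  rw [M0, exp_mul_log_div_sub h.dim_pos.ne']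
  set P := ⨆ θ ∈ paramSpace d, ENNReal.ofReal (prior θ)
  rcases eq_or_ne P ∞ with hP | hP
  · simp [hP, ENNReal.top_div_of_ne_top, Real.exp_pos]
  have hS (θ) (hθ : θ ∈ paramSpace d) : prior θ ≤ P.toReal :=
    (ENNReal.ofReal_le_iff_le_toReal hP).1
      (le_iSup₂ (f := fun θ (_ : θ ∈ paramSpace d) => ENNReal.ofReal (prior θ)) θ hθ)
  have hε : 0 ≤ s * d / √(n * minProb θs) := by positivity
  have hδ : 0 ≤ D / √n := div_nonneg hp.bound_nonneg (Real.sqrt_nonneg _)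
  refine (tv_localPosterior_le h hp hD hs hS).trans_eq ?_
  rw [ENNReal.ofReal_mul (by norm_num), ENNReal.ofReal_add (by positivity) (by positivity),
    ENNReal.ofReal_add hε hδ, ENNReal.ofReal_mul (by positivity), ENNReal.ofReal_div_of_pos hpos,
    ENNReal.ofReal_toReal hP, mul_left_comm, mul_assoc]

end PosteriorApproximation

section Posterior
open scoped ENNReal
variable {d n : ℕ} {s D : ℝ} {θs : EuclideanSpace ℝ (Fin d)} {N : Fin (d + 1) → ℕ}
  {prior : EuclideanSpace ℝ (Fin d) → ℝ}

lemma exists_isLocalFrame (hd : 0 < d) (hn : 0 < n) (hθ : θs ∈ paramSpace d) (hs : 0 < s)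
    (hsmall : 8 * (s * √d) ≤ √(n * minProb θs)) {p : EuclideanSpace ℝ (Fin d)}
    (hclose : wnorm (fisher θs) (p - θs) ≤ s / 2 * √((d : ℝ) / n)) :
    ∃ L, IsLocalFrame n (s * √d) θs p L := by
  have hn' : (0 : ℝ) < n := by exact_mod_cast hn
  obtain ⟨L, hL⟩ := exists_isFisherFrame hθ hn'
  refine ⟨L, hL, hθ, hn, by positivity, hsmall, ?_⟩
  rwa [← L.apply_symm_apply (p - θs), hL.wnorm_eq hn', Real.sqrt_div (Nat.cast_nonneg d),
    mul_div_assoc', div_le_div_iff_of_pos_right (Real.sqrt_pos.2 hn'), div_mul_eq_mul_div] at hclose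

lemma eight_mul_mul_sqrt_le_sqrt {m : ℝ} (hm : 0 < m) (h : s ^ 2 * d / m ≤ 1 / 64) :
    8 * (s * √d) ≤ √m := by
  refine Real.le_sqrt_of_sq_le ?_
  rw [mul_pow, mul_pow, Real.sq_sqrt (Nat.cast_nonneg d)]
  linarith [(div_le_iff₀ hm).1 h]

theorem isProbabilityMeasure_posterior_and_tv_le (hd : 0 < d) (hn : 0 < n) (hθ : θs ∈ paramSpace d)
    (hprior : ∀ θ ∈ paramSpace d, 0 ≤ prior θ)
    (hint : IntegrableOn prior (paramSpace d) volume) (hs : 48 ≤ s)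
    (hsmall : 8 * (s * √d) ≤ √(n * minProb θs))
    (hδ : delta01 n θs prior (2 * s) ≤ ENNReal.ofReal (√(n * d) / 6))
    (hN : ∑ j, N j = n)
    (hclose : wnorm (fisher θs) (freq n N - θs) ≤ s / 2 * √((d : ℝ) / n)) :
    freq n N ∈ paramSpace d ∧ IsProbabilityMeasure (posterior n prior N) ∧
      tv (posterior n prior N) (multivariateGaussian (freq n N) ((n : ℝ) • fisher θs)⁻¹) ≤
        ENNReal.ofReal 40 *
          (ENNReal.ofReal (s * d / √(n * minProb θs)) +
            delta01 n θs prior (2 * s) / ENNReal.ofReal √n +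
            EReal.exp ((d : EReal) * (M0 θs prior - ((1 / 128 * s ^ 2 : ℝ) : EReal)))) := by
  obtain ⟨L, h⟩ := exists_isLocalFrame hd hn hθ (by linarith) hsmall hclose
  have hδ_top : delta01 n θs prior (2 * s) ≠ ∞ := (hδ.trans_lt ENNReal.ofReal_lt_top).ne
  have hp := isRegularPrior_of_delta01_ne_top hδ_top
  have hD := ENNReal.toReal_le_of_le_ofReal (by positivity) hδ
  have := isFiniteMeasure_localPosterior hn hN L hprior hint
  have : NeZero (localPosterior n (freq n N) L prior) := h.neZero_localPosterior hp hD (by linarith)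
  have : IsProbabilityMeasure (localPosterior n (freq n N) L prior)[|.univ] :=
    cond_isProbabilityMeasure (NeZero.ne _)
  have hmeas : Measurable fun x => freq n N + L x := by fun_prop
  rw [posterior_eq_map hn hN L prior, h.multivariateGaussian_eq_map, ← ENNReal.ofReal_toReal hδ_top,
    ← ENNReal.ofReal_div_of_pos (Real.sqrt_pos.2 h.n_pos_real)]
  exact ⟨h.center_mem, Measure.isProbabilityMeasure_map hmeas.aemeasurable,
    (tv_map_le _ _ hmeas).trans (tv_localPosterior_le_exp_M0 h hp hD hs)⟩

end Posterior

end MultinomialBvM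

theorem corollary5p5 :
    ∃ s₀ c₀ C K : ℝ, 0 < s₀ ∧ 0 < c₀ ∧ 0 < C ∧ 0 < K ∧
      ∀ (d n : ℕ), 1 ≤ d → 1 ≤ n →
      ∀ θs ∈ MultinomialBvM.paramSpace d,
      ∀ prior : EuclideanSpace ℝ (Fin d) → ℝ,
        (∀ θ ∈ MultinomialBvM.paramSpace d, 0 ≤ prior θ) →
        IntegrableOn prior (MultinomialBvM.paramSpace d) volume →
      ∀ s : ℝ, s₀ ≤ s →
        s ^ 2 * d / (n * MultinomialBvM.minProb θs) ≤ c₀ →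
        MultinomialBvM.delta01 n θs prior (2 * s) ≤ ENNReal.ofReal (Real.sqrt (n * d) / 6) →
        1 - Real.exp (-(C * d * s ^ 2)) ≤
          (MultinomialBvM.multinomial n θs).real
            {N | IsProbabilityMeasure (MultinomialBvM.posterior n prior N) ∧
              ∃ θhat : EuclideanSpace ℝ (Fin d),
                MultinomialBvM.IsMLE n N θhat ∧
                (∀ θ, MultinomialBvM.IsMLE n N θ → θ = θhat) ∧
                MultinomialBvM.tv (MultinomialBvM.posterior n prior N)
                    (multivariateGaussian θhat ((n : ℝ) • MultinomialBvM.fisher θs)⁻¹) ≤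
                  ENNReal.ofReal K *
                    (ENNReal.ofReal (s * d / Real.sqrt (n * MultinomialBvM.minProb θs)) +
                      MultinomialBvM.delta01 n θs prior (2 * s) / ENNReal.ofReal (Real.sqrt n) +
                      EReal.exp ((d : EReal) *
                        (MultinomialBvM.M0 θs prior - ((C * s ^ 2 : ℝ) : EReal))))} := by
  refine ⟨48, 1 / 64, 1 / 128, 40, by norm_num, by norm_num, by norm_num, by norm_num, ?_⟩
  intro d n hd hn θs hθ prior hprior hint s hs hc hδ
  have hnθ : 0 < n * MultinomialBvM.minProb θs :=
    mul_pos (by exact_mod_cast hn) (MultinomialBvM.minProb_pos hθ)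
  have hsmall := MultinomialBvM.eight_mul_mul_sqrt_le_sqrt hnθ hc
  have := MultinomialBvM.isProbabilityMeasure_multinomial n hθ
  refine (MultinomialBvM.multinomial_concentration hn hd hθ (by linarith) hsmall).trans
    (measureReal_mono ?_)
  rintro N ⟨hN, hclose⟩
  obtain ⟨hmem, hprob, htv⟩ := MultinomialBvM.isProbabilityMeasure_posterior_and_tv_le
    hd hn hθ hprior hint hs hsmall hδ hN hclose
  exact ⟨hprob, MultinomialBvM.freq n N, MultinomialBvM.isMLE_freq hn hN hmem,
    fun θ => MultinomialBvM.eq_freq_of_isMLE hn hN hmem, htv⟩
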